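/- Let $p$ be a prime and let $(K,v)$ be a field with a Krull valuation, with value group $v(K)$ and valuation ring $O_v(K)$, whose residue field has characteristic $p$ and for which $v(K)\neq p\,v(K)$. Fix a separable closure $K_{\rm sep}$ of $K$, let $K(p)$ be the compositum of all finite Galois extensions of $K$ in $K_{\rm sep}$ of $p$-power degree, and assume that $v$ is $p$-Henselian, i.e. that $v$ extends uniquely, up to equivalence, to each intermediate field of $K(p)/K$. Let $K_{h(v)}\subseteq K_{\rm sep}$ be a Henselization of $(K,v)$ (the decomposition field of an extension of $v$ to $K_{\rm sep}$). Let $G(K)$ be the minimal isolated (i.e. convex) subgroup of $v(K)$ containing $v(p)$ when ${\rm char}(K)\ne p$. If ${\rm char}(K)\neq p$, let $\varepsilon\in K_{\rm sep}$ be a primitive $p$-th root of unity, let $m=[K(\varepsilon):K]$, let $v'$ be a valuation of $K(\varepsilon)$ extending $v$, and define $\Delta(v)\le v(K)$ as follows: $\Delta(v)=G(K)$ if $\varepsilon\notin K_{h(v)}$; if $\varepsilon\in K_{h(v)}$, then $\Delta(v)$ is the minimal isolated subgroup of $v(K)$ containing the values $v'((\varepsilon-c)^m)$ for all $c\in O_v(K)$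 with $c\neq\varepsilon$. Then $K$ has no totally ramified extension of degree $p$ in $K(p)$ (i.e. no $L$ with $K\subseteq L\subseteq K(p)$ and $[L:K]=p=[v(L):v(K)]$, where $v(L)$ is the value group of the extension of $v$ to $L$) if and only if ${\rm char}(K)=0$ and one of the following conditions holds: (i) $G(K)=pG(K)$ and $K_{h(v)}$ contains no primitive $p$-th root of unity; (ii) $K_{h(v)}$ contains a primitive $p$-th root of unity and $\Delta(v)=p\Delta(v)$. -/

import Mathlib

open scoped IntermediateField

/-- The value group `v(K)` of a valuation, as a type. It is written multiplicatively, with the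
reverse of the additive order; this affects neither isolated subgroups nor divisibility. -/
abbrev ValGroup {K Γ : Type*} [Field K] [LinearOrderedCommGroupWithZero Γ]
    (v : Valuation K Γ) : Type _ :=
  MonoidWithZeroHom.valueGroup (.ofClass v)

/-- `H = pH` for a subgroup `H` of an abelian group (in multiplicative notation). -/
def IsPDivisible {A : Type*} [CommGroup A] (p : ℕ) (H : Subgroup A) : Prop :=
  ∀ h ∈ H, ∃ k ∈ H, k ^ p = h

/-- The smallest isolated (i.e. convex) subgroup of an ordered abelian group containing `S`. -/
def isolatedHull {A : Type*} [CommGroup A] [LinearOrder A] (S : Set A) : Subgroup A :=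
  sInf {H : Subgroup A | (H : Set A).OrdConnected ∧ S ⊆ H}

/-- `G(K)`: the minimal isolated subgroup of `v(K)` containing `v(p)`. -/
def groupG {K Γ : Type*} [Field K] [LinearOrderedCommGroupWithZero Γ]
    (v : Valuation K Γ) (p : ℕ) : Subgroup (ValGroup v) :=
  isolatedHull {γ : ValGroup v | ((γ : Γˣ) : Γ) = v (p : K)}

/-- The maximal `p`-extension `K(p)` of `K` in `Ks`: the compositum of all finite Galois
extensions of `K` in `Ks` of `p`-power degree. -/
def maximalPExtension (p : ℕ) (K Ks : Type*) [Field K] [Field Ks] [Algebra K Ks] :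
    IntermediateField K Ks :=
  sSup {L : IntermediateField K Ks | IsGalois K L ∧ ∃ n : ℕ, Module.finrank K L = p ^ n}

/-- `v` is `p`-Henselian: on every intermediate field of `K(p)/K` there is, up to equivalence
(i.e. up to equality of valuation rings), exactly one valuation extending `v`. -/
def IsPHenselian {K Γ : Type*} [Field K] [LinearOrderedCommGroupWithZero Γ]
    (v : Valuation K Γ) (p : ℕ) (Ks : Type*) [Field Ks] [Algebra K Ks] : Prop :=
  ∀ L : IntermediateField K Ks, L ≤ maximalPExtension p K Ks →
    ∃! B : ValuationSubring L, B.comap (algebraMap K L) = v.valuationSubring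

/-- `F` is a Henselization of `(K, v)` inside the separable closure `Ks`: the decomposition
field of some extension of `v` to `Ks`. -/
def IsHenselizationIn {K Γ Ks : Type*} [Field K] [LinearOrderedCommGroupWithZero Γ]
    [Field Ks] [Algebra K Ks] (v : Valuation K Γ) (F : IntermediateField K Ks) : Prop :=
  ∃ W : ValuationSubring Ks, W.comap (algebraMap K Ks) = v.valuationSubring ∧
    F = IntermediateField.fixedField (W.decompositionSubgroup K)

/-- A finite extension `L/K` is totally ramified relative to `v`: for an extension `B` of `v`
to `L`, the index of `v(K)` in the value group of `L` equals `[L : K]`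
(`B` is then the only extension of `v` to `L`). -/
def IsTotallyRamified {K Γ : Type*} [Field K] [LinearOrderedCommGroupWithZero Γ]
    (v : Valuation K Γ) (L : Type*) [Field L] [Algebra K L] : Prop :=
  FiniteDimensional K L ∧
    ∃ B : ValuationSubring L, B.comap (algebraMap K L) = v.valuationSubring ∧
      (MonoidWithZeroHom.valueGroup (.ofClass (B.valuation.comap (algebraMap K L)))).relIndex
        (MonoidWithZeroHom.valueGroup (.ofClass B.valuation)) = Module.finrank K L

open Classical in
/-- `Δ(v)`, computed from a Henselization `Kh` of `(K, v)`, a primitive `p`-th root of unity `ε`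
and an extension `v'` of `v` to `K(ε)`. It is `G(K)` if `ε ∉ Kh`. If `ε ∈ Kh`, it is the minimal
isolated subgroup of `v(K)` containing the values `v'((ε - c) ^ m)`, where `m = [K(ε) : K]` and
`c ≠ ε` runs over the valuation ring of `v`. That `γ = v(x) ∈ v(K)` is the value of `(ε - c) ^ m`
is expressed by `v'(x) = v'((ε - c) ^ m)`. -/
noncomputable def groupDelta {K Γ Γ' Ks : Type*} [Field K] [LinearOrderedCommGroupWithZero Γ]
    [LinearOrderedCommGroupWithZero Γ'] [Field Ks] [Algebra K Ks] (v : Valuation K Γ) (p : ℕ)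
    (Kh : IntermediateField K Ks) (ε : Ks) (v' : Valuation K⟮ε⟯ Γ') : Subgroup (ValGroup v) :=
  if ε ∈ Kh then
    isolatedHull {γ : ValGroup v | ∃ c x : K, v c ≤ 1 ∧ algebraMap K Ks c ≠ ε ∧
      ((γ : Γˣ) : Γ) = v x ∧
      v' (algebraMap K K⟮ε⟯ x) =
        v' ((IntermediateField.AdjoinSimple.gen K ε - algebraMap K K⟮ε⟯ c) ^
          Module.finrank K K⟮ε⟯)}
  else groupG v p

/-! Values are multiplicative, so `v p < 1`; `w` stands for an extension of `v` to `Ks`, and m =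
[K(ε) : K], which is prime to p. Each failure of the conditions is answered by an explicit
extension, and conversely a totally ramified extension forces an approximation of ε by elements of
K.

Construction. In characteristic p, a root of X ^ p - X = a is ramified when w(a) > 1 is not a p-th
power in the value group. In characteristic 0 one takes a p-th root β of some b in K(ε) and
descends: if the class of b modulo p-th powers transforms under Galois as ε does, and K(ε, β) has a
value of order p modulo v(K), then K(ε, β) contains a Galois extension of K of degree p over which
its degree is less than p, so this value already occurs there
(`exists_isGalois_finrank_eq_of_kummer`). Suitable b come from an eigenspace projection
(`twistedProd`). If G(K) is not p-divisible, 1 + (ε - 1)a with w(p) < w(a) ≤ 1 is projected, and β -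
1 provides the value (`hasRamifiedExtension_of_lt`). If G(K) is p-divisible and Δ(v) is not, ε - c
is projected, where c in K is closer to ε than 1 is, so that the other conjugates contribute only
p-th powers (`hasRamifiedExtension_of_close`).

Obstruction. Let D be a p-divisible isolated subgroup containing v(p), and L/K totally ramified of
degree p inside K(p). Coarsening by D makes p a unit, and L stays totally ramified because D is
p-divisible. Ramification is now tame, so the Galois action on a ramified element yields a
nontrivial p-th root of unity in the residue field of K: some c in K satisfies ε ≡ c
(`exists_coarsening_valuation_sub_lt_one`). For D = G(K), the decomposition group must then fix ε,
which contradicts (i). For D = Δ(v), the value of (ε - c) ^ m lies in D by definition, so ε - c is a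
unit of the coarsening, which is absurd. -/

/-! ### Values modulo the value group of the base field, and ramification index against degree. -/

section ValueIndependence

variable {K L Γ₀ : Type*} [Field K] [Field L] [Algebra K L] [LinearOrderedCommGroupWithZero Γ₀]
  (w : Valuation L Γ₀)

/-- A sum of terms with pairwise distinct values has the value of its dominant term. -/
theorem Valuation.exists_dominant_of_pairwise_ne {ι : Type*} (s : Finset ι) (f : ι → L)
    (hf : ∀ i ∈ s, ∀ j ∈ s, i ≠ j → f i ≠ 0 → w (f i) ≠ w (f j)) (hs : ∃ i ∈ s, f i ≠ 0) :
    ∃ i ∈ s, f i ≠ 0 ∧ w (∑ i ∈ s, f i) = w (f i) ∧ ∀ j ∈ s, j ≠ i → w (f j) < w (f i) := by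
  classical
  obtain ⟨i₀, hi₀, h₀⟩ := hs
  obtain ⟨i, hi, hmax⟩ := s.exists_max_image (fun i ↦ w (f i)) ⟨i₀, hi₀⟩
  have hne : f i ≠ 0 := fun h ↦ by
    have := hmax i₀ hi₀
    simp [h, h₀] at this
  have hlt : ∀ j ∈ s, j ≠ i → w (f j) < w (f i) := fun j hj hji ↦
    lt_of_le_of_ne (hmax j hj) fun h ↦ hf i hi j hj hji.symm hne h.symm
  refine ⟨i, hi, hne, w.map_sum_eq_of_lt hi fun j hj ↦ ?_, hlt⟩
  simp only [Finset.mem_sdiff, Finset.mem_singleton] at hj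
  exact hlt j hj.1 hj.2

theorem Valuation.mul_smul_ne_of_ne {ι : Type*} {z : ι → L}
    (h : ∀ i j, i ≠ j → ∀ k : K, w (z i) ≠ w (algebraMap K L k) * w (z j)) (g : ι → K) {i j : ι}
    (hij : i ≠ j) (hi : g i • z i ≠ 0) : w (g i • z i) ≠ w (g j • z j) := by
  intro he
  have hgi : w (algebraMap K L (g i)) ≠ 0 := by
    rintro h0
    simp only [map_eq_zero] at h0
    simp [h0] at hi
  apply h i j hij ((g i)⁻¹ * g j)
  rw [Algebra.smul_def, Algebra.smul_def, map_mul, map_mul] at he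
  rw [map_mul, map_mul, map_inv₀, map_inv₀, mul_assoc, ← he, inv_mul_cancel_left₀ hgi]

/-- Elements whose values lie in distinct cosets of the value group of `K` are linearly
independent over `K`. -/
theorem Valuation.linearIndependent_of_ne {ι : Type*} {z : ι → L} (hz : ∀ i, z i ≠ 0)
    (h : ∀ i j, i ≠ j → ∀ k : K, w (z i) ≠ w (algebraMap K L k) * w (z j)) :
    LinearIndependent K z := by
  rw [linearIndependent_iff']
  intro s g hg i hi
  by_contra hgi
  obtain ⟨j, hj, hne, he, -⟩ := w.exists_dominant_of_pairwise_ne s (fun i ↦ g i • z i)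
    (fun i _ j _ hij hi ↦ w.mul_smul_ne_of_ne h g hij hi)
    ⟨i, hi, smul_ne_zero hgi (hz i)⟩
  rw [hg, map_zero, eq_comm, map_eq_zero] at he
  exact hne he

variable {p : ℕ}

/-- If the value of `y` has order `p` modulo the value group of `K`, the values of the powers of `y`
with exponent prime to `p` do not lie in the value group of `K`. -/
theorem Valuation.zpow_ne_of_ne (hp : p.Prime) {y : L} (hy : ∀ k : K, w y ≠ w (algebraMap K L k))
    {k₀ : K} (hk₀ : w y ^ p = w (algebraMap K L k₀)) {i : ℤ} (hi : ¬ (p : ℤ) ∣ i) (k : K) :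
    w y ^ i ≠ w (algebraMap K L k) := by
  intro he
  have hy0 : w y ≠ 0 := by simpa using hy 0
  obtain ⟨u, v, huv⟩ : IsCoprime (p : ℤ) i :=
    (Nat.prime_iff_prime_int.1 hp).coprime_iff_not_dvd.2 hi
  apply hy (k₀ ^ u * k ^ v)
  rw [map_mul, map_mul, map_zpow₀, map_zpow₀, map_zpow₀, map_zpow₀, ← hk₀, ← he, ← zpow_natCast,
    ← zpow_mul, ← zpow_mul, ← zpow_add₀ hy0, mul_comm _ u, mul_comm _ v, huv, zpow_one]

theorem Valuation.pow_ne_mul_pow_of_ne (hp : p.Prime) {y : L}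
    (hy : ∀ k : K, w y ≠ w (algebraMap K L k))
    {k₀ : K} (hk₀ : w y ^ p = w (algebraMap K L k₀)) (i j : Fin p) (hij : i ≠ j) (k : K) :
    w (y ^ (i : ℕ)) ≠ w (algebraMap K L k) * w (y ^ (j : ℕ)) := by
  have hy0 : w y ≠ 0 := by simpa using hy 0
  intro he
  refine w.zpow_ne_of_ne hp hy hk₀ (i := (i : ℤ) - j) ?_ k ?_
  · rintro ⟨c, hc⟩
    have h1 := i.2
    have h2 := j.2
    apply hij
    have : c = 0 := by
      have hp0 : (0 : ℤ) < p := by exact_mod_cast hp.pos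
      have a1 : (p : ℤ) * c < p * 1 := by rw [← hc]; omega
      have a2 : (p : ℤ) * (-1) < p * c := by rw [← hc]; omega
      have := lt_of_mul_lt_mul_left a1 hp0.le
      have := lt_of_mul_lt_mul_left a2 hp0.le
      omega
    subst this
    ext; omega
  · rw [zpow_sub₀ hy0, zpow_natCast, zpow_natCast, ← map_pow, he, map_pow,
      mul_div_assoc, div_self (pow_ne_zero _ hy0), mul_one]

theorem Valuation.linearIndependent_pow_of_ne (hp : p.Prime) {y : L}
    (hy : ∀ k : K, w y ≠ w (algebraMap K L k))
    {k₀ : K} (hk₀ : w y ^ p = w (algebraMap K L k₀)) :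
    LinearIndependent K fun i : Fin p ↦ y ^ (i : ℕ) := by
  have hy0 : y ≠ 0 := by rintro rfl; exact hy 0 (by simp)
  exact w.linearIndependent_of_ne (fun i ↦ pow_ne_zero _ hy0) (w.pow_ne_mul_pow_of_ne hp hy hk₀)

theorem Valuation.le_finrank_of_ne [FiniteDimensional K L] (hp : p.Prime) {y : L}
    (hy : ∀ k : K, w y ≠ w (algebraMap K L k))
    {k₀ : K} (hk₀ : w y ^ p = w (algebraMap K L k₀)) : p ≤ Module.finrank K L := by
  simpa using (w.linearIndependent_pow_of_ne hp hy hk₀).fintype_card_le_finrank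

/-- If `[L : K] = p` and the value of `y ∈ L` has order `p` modulo the value group of `K`, then `L`
has the same residue field as `K`. -/
theorem Valuation.exists_sub_lt_one (hp : p.Prime) (hfin : Module.finrank K L = p) {y : L}
    (hy : ∀ k : K, w y ≠ w (algebraMap K L k)) {k₀ : K} (hk₀ : w y ^ p = w (algebraMap K L k₀))
    {x : L} (hx : w x = 1) : ∃ a : K, w (x - algebraMap K L a) < 1 := by
  classical
  have hy0 : y ≠ 0 := by rintro rfl; exact hy 0 (by simp)
  have : Nonempty (Fin p) := ⟨⟨0, hp.pos⟩⟩
  let b := basisOfLinearIndependentOfCardEqFinrank (w.linearIndependent_pow_of_ne hp hy hk₀)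
    (by simp [hfin])
  have hb : ∀ i, b i = y ^ (i : ℕ) := fun i ↦ by simp [b]
  have hsum := b.sum_repr x
  set f : Fin p → L := fun i ↦ b.repr x i • y ^ (i : ℕ) with hf
  have hsum' : ∑ i, f i = x := by rw [← hsum]; simp [hf, hb]
  have hnz : ∃ i ∈ Finset.univ, f i ≠ 0 := by
    by_contra! h
    rw [Finset.sum_eq_zero h] at hsum'
    simp [← hsum'] at hx
  obtain ⟨i, -, hi0, hi, hlt⟩ := w.exists_dominant_of_pairwise_ne Finset.univ f
    (fun i _ j _ hij hi ↦ w.mul_smul_ne_of_ne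
      (w.pow_ne_mul_pow_of_ne hp hy hk₀) (fun i ↦ b.repr x i) hij hi) hnz
  rw [hsum', hx] at hi
  -- The dominant term has value 1, which lies in the value group of K; among the powers of `y` only
  -- the exponent 0 allows this. Its coefficient is the required residue.
  have hi' : (i : ℕ) = 0 := by
    by_contra hne
    refine w.zpow_ne_of_ne hp hy hk₀ (i := (i : ℕ)) ?_ (b.repr x i)⁻¹ ?_
    · rw [Int.natCast_dvd_natCast]
      exact fun h ↦ absurd (Nat.le_of_dvd (Nat.pos_of_ne_zero hne) h) (not_le.2 i.2)
    · rw [zpow_natCast, map_inv₀, map_inv₀]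
      simp only [hf, Algebra.smul_def, map_mul, map_pow] at hi
      exact eq_inv_of_mul_eq_one_right hi.symm
  refine ⟨b.repr x i, ?_⟩
  have hfi : f i = algebraMap K L (b.repr x i) := by simp [hf, hi', Algebra.smul_def]
  rw [← hfi, ← hsum', ← Finset.add_sum_erase _ _ (Finset.mem_univ i), add_sub_cancel_left, hi]
  refine w.map_sum_lt (by rw [← hi]; exact one_ne_zero) fun j hj ↦ hlt j (Finset.mem_univ _) ?_
  exact Finset.ne_of_mem_erase hj

theorem Valuation.exists_eq_of_mem_valueGroup {F : Type*} [Field F] (u : Valuation F Γ₀)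
    {γ : Γ₀ˣ} (hγ : γ ∈ MonoidWithZeroHom.valueGroup (.ofClass u)) : ∃ x : F, u x = γ := by
  rw [MonoidWithZeroHom.mem_valueGroup_iff_of_comm'] at hγ
  obtain ⟨a, ha, x, hx, h⟩ := hγ
  refine ⟨x / a, ?_⟩
  simp only [MonoidWithZeroHom.coe_ofClass] at h ha
  rw [map_div₀, ← h, mul_div_cancel_left₀ _ ha]

theorem Valuation.mem_valueGroup_of_eq {F : Type*} [Field F] (u : Valuation F Γ₀)
    {γ : Γ₀ˣ} {x : F} (hx : u x = γ) : γ ∈ MonoidWithZeroHom.valueGroup (.ofClass u) :=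
  MonoidWithZeroHom.mem_valueGroup _ ⟨x, hx⟩

/-- Coset representatives are independent over K. Finiteness is recorded separately because
`relIndex` takes the default value 0 on infinite quotients. -/
theorem Valuation.finite_quotient_and_card_le_finrank [FiniteDimensional K L] :
    Finite (MonoidWithZeroHom.valueGroup (.ofClass w) ⧸
      (MonoidWithZeroHom.valueGroup (.ofClass (w.comap (algebraMap K L)))).subgroupOf
        (MonoidWithZeroHom.valueGroup (.ofClass w))) ∧
    (MonoidWithZeroHom.valueGroup (.ofClass (w.comap (algebraMap K L)))).relIndex
      (MonoidWithZeroHom.valueGroup (.ofClass w)) ≤ Module.finrank K L := by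
  set A := MonoidWithZeroHom.valueGroup (.ofClass w)
  set H := MonoidWithZeroHom.valueGroup (.ofClass (w.comap (algebraMap K L)))
  choose z hz using fun q : A ⧸ H.subgroupOf A ↦ w.exists_eq_of_mem_valueGroup q.out.2
  have hind : LinearIndependent K z := by
    refine w.linearIndependent_of_ne (fun q h ↦ ?_) fun q r hqr k he ↦ hqr ?_
    · have := hz q
      rw [h, map_zero] at this
      exact (Units.ne_zero _ this.symm).elim
    · rw [hz, hz] at he
      rw [← q.out_eq', ← r.out_eq', eq_comm, QuotientGroup.eq, Subgroup.mem_subgroupOf]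
      refine Valuation.mem_valueGroup_of_eq (x := k) _ ?_
      simp [he, mul_comm]
  have hfin : Finite (A ⧸ H.subgroupOf A) := hind.finite
  refine ⟨hfin, ?_⟩
  cases nonempty_fintype (A ⧸ H.subgroupOf A)
  rw [Subgroup.relIndex, Subgroup.index, Nat.card_eq_fintype_card]
  exact hind.fintype_card_le_finrank

theorem Valuation.relIndex_eq_of_ne [FiniteDimensional K L] (hp : p.Prime)
    (hfin : Module.finrank K L = p) {y : L} (hy : ∀ k : K, w y ≠ w (algebraMap K L k))
    {k₀ : K} (hk₀ : w y ^ p = w (algebraMap K L k₀)) :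
    (MonoidWithZeroHom.valueGroup (.ofClass (w.comap (algebraMap K L)))).relIndex
      (MonoidWithZeroHom.valueGroup (.ofClass w)) = Module.finrank K L := by
  obtain ⟨hq, hle⟩ := w.finite_quotient_and_card_le_finrank (K := K)
  refine le_antisymm hle ?_
  rw [hfin]
  have hy0 : w y ≠ 0 := by simpa using hy 0
  set A := MonoidWithZeroHom.valueGroup (.ofClass w)
  set H := MonoidWithZeroHom.valueGroup (.ofClass (w.comap (algebraMap K L)))
  let g : A := ⟨Units.mk0 (w y) hy0, w.mem_valueGroup_of_eq (x := y) rfl⟩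
  have := Fact.mk hp
  have hord : orderOf (g : A ⧸ H.subgroupOf A) = p := by
    refine orderOf_eq_prime ?_ ?_
    · rw [← QuotientGroup.mk_pow, QuotientGroup.eq_one_iff, Subgroup.mem_subgroupOf]
      exact Valuation.mem_valueGroup_of_eq (x := k₀) _ (by simp [g, hk₀])
    · rw [Ne, QuotientGroup.eq_one_iff, Subgroup.mem_subgroupOf]
      intro h
      obtain ⟨k, hk⟩ := Valuation.exists_eq_of_mem_valueGroup _ h
      exact hy k (by simpa [g] using hk.symm)
  rw [Subgroup.relIndex, Subgroup.index]
  exact Nat.le_of_dvd Nat.card_pos (hord ▸ orderOf_dvd_natCard _)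

theorem Valuation.exists_ne_of_relIndex_eq (hp : p.Prime)
    (h : (MonoidWithZeroHom.valueGroup (.ofClass (w.comap (algebraMap K L)))).relIndex
      (MonoidWithZeroHom.valueGroup (.ofClass w)) = p) :
    ∃ y : L, (∀ k : K, w y ≠ w (algebraMap K L k)) ∧ ∃ k₀ : K, w y ^ p = w (algebraMap K L k₀) := by
  set A := MonoidWithZeroHom.valueGroup (.ofClass w)
  set H := MonoidWithZeroHom.valueGroup (.ofClass (w.comap (algebraMap K L)))
  have hne : ¬ A ≤ H := by
    rw [← Subgroup.relIndex_eq_one, h]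
    exact hp.ne_one
  obtain ⟨g, hg, hgH⟩ := Set.not_subset.1 hne
  obtain ⟨y, hy⟩ := w.exists_eq_of_mem_valueGroup hg
  refine ⟨y, fun k hk ↦ hgH (Valuation.mem_valueGroup_of_eq (x := k) _ (by simp [← hy, hk])), ?_⟩
  have hpow : g ^ p ∈ H := by
    have := Subgroup.pow_index_mem (H.subgroupOf A) (⟨g, hg⟩ : A)
    rw [← Subgroup.relIndex, h, Subgroup.mem_subgroupOf] at this
    simpa using this
  obtain ⟨k, hk⟩ := Valuation.exists_eq_of_mem_valueGroup _ hpow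
  exact ⟨k, by simpa [hy] using hk.symm⟩

end ValueIndependence

/-! ### Galois theory inside the maximal p-extension. -/

section PExtensions

variable {K Ks : Type*} [Field K] [Field Ks] [Algebra K Ks] {p : ℕ}

/-- The compositum corresponds to the intersection of the fixing subgroups, whose index divides the
product of the two indices because the first subgroup is normal. -/
theorem IntermediateField.exists_finrank_sup_eq_pow [IsGalois K Ks] (hp : p.Prime)
    {L₁ L₂ : IntermediateField K Ks} [IsGalois K L₁] {a b : ℕ}
    (h₁ : Module.finrank K L₁ = p ^ a) (h₂ : Module.finrank K L₂ = p ^ b) :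
    ∃ n, Module.finrank K ↥(L₁ ⊔ L₂) = p ^ n := by
  rw [IntermediateField.finrank_eq_fixingSubgroup_index] at h₁ h₂ ⊢
  rw [IntermediateField.fixingSubgroup_sup]
  have hd : (L₁.fixingSubgroup ⊓ L₂.fixingSubgroup).index ∣ p ^ (a + b) := by
    rw [← Subgroup.relIndex_mul_index (inf_le_right : L₁.fixingSubgroup ⊓ L₂.fixingSubgroup ≤ _),
      Subgroup.inf_relIndex_right, pow_add]
    have hN : L₁.fixingSubgroup.Normal := inferInstance
    exact mul_dvd_mul (h₁ ▸ Subgroup.relIndex_dvd_index_of_normal _ _) h₂.dvd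
  obtain ⟨n, -, hn⟩ := (Nat.dvd_prime_pow hp).1 hd
  exact ⟨n, hn⟩

/-- Modulo `N` this is the fact that a subgroup of index p in a finite p-group is normal. -/
theorem Subgroup.normal_of_index_eq_prime_of_le {G : Type*} [Group G] (hp : p.Prime)
    {H N : Subgroup G} [N.Normal] (hNH : N ≤ H) (hH : H.index = p) {n : ℕ}
    (hN : N.index = p ^ n) : H.Normal := by
  have hs := QuotientGroup.mk'_surjective N
  have hker : (QuotientGroup.mk' N).ker ≤ H := by rwa [QuotientGroup.ker_mk']
  have hcomap : (H.map (QuotientGroup.mk' N)).comap (QuotientGroup.mk' N) = H :=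
    Subgroup.comap_map_eq_self hker
  have hindex : (H.map (QuotientGroup.mk' N)).index = p := by
    rw [← Subgroup.index_comap_of_surjective _ hs, hcomap, hH]
  have hcard : Nat.card (G ⧸ N) = p ^ n := hN
  have hn : n ≠ 0 := by
    rintro rfl
    have := (H.map (QuotientGroup.mk' N)).index_dvd_card
    rw [hcard, hindex, pow_zero] at this
    exact hp.ne_one (Nat.dvd_one.1 this)
  have := Subgroup.normal_of_index_eq_minFac_card (H := H.map (QuotientGroup.mk' N))
    (by rw [hindex, hcard, hp.pow_minFac hn])
  rw [← hcomap]
  infer_instance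

/-- A subextension of degree `p` of the maximal `p`-extension is Galois. -/
theorem isGalois_of_le_maximalPExtension [IsGalois K Ks] (hp : p.Prime)
    {L : IntermediateField K Ks} (hL : L ≤ maximalPExtension p K Ks)
    (hfin : Module.finrank K L = p) : IsGalois K L := by
  have : FiniteDimensional K L := FiniteDimensional.of_finrank_pos (hfin ▸ hp.pos)
  obtain ⟨s, hs⟩ := L.fg_of_fg_toSubalgebra
    (Subalgebra.fg_of_fg_toSubmodule (Module.Finite.iff_fg.1 ‹FiniteDimensional K L›))
  -- Being finitely generated, `L` is compact in the lattice of intermediate fields, hence lies in a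
  -- single member of the directed family with supremum K(p).
  have hc : IsCompactElement L := hs ▸ IntermediateField.adjoin_finset_isCompactElement s
  rw [CompleteLattice.isCompactElement_iff_le_of_directed_sSup_le] at hc
  have hne : {M : IntermediateField K Ks | IsGalois K M ∧
      ∃ n : ℕ, Module.finrank K M = p ^ n}.Nonempty := ⟨⊥, inferInstance, 0, by simp⟩
  have hdir : DirectedOn (· ≤ ·) {M : IntermediateField K Ks | IsGalois K M ∧
      ∃ n : ℕ, Module.finrank K M = p ^ n} := by
    rintro M₁ ⟨hM₁, a, ha⟩ M₂ ⟨hM₂, b, hb⟩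
    exact ⟨M₁ ⊔ M₂, ⟨inferInstance, IntermediateField.exists_finrank_sup_eq_pow hp ha hb⟩,
      le_sup_left, le_sup_right⟩
  obtain ⟨M, ⟨hM, n, hn⟩, hLM⟩ := hc _ hne hdir hL
  rw [IntermediateField.finrank_eq_fixingSubgroup_index] at hn hfin
  rw [← InfiniteGalois.normal_iff_isGalois]
  exact Subgroup.normal_of_index_eq_prime_of_le hp
    (IntermediateField.fixingSubgroup_antitone hLM) hfin hn

theorem le_maximalPExtension {L : IntermediateField K Ks} [hL : IsGalois K L]
    (hfin : Module.finrank K L = p) : L ≤ maximalPExtension p K Ks :=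
  le_sSup ⟨hL, 1, by rw [hfin, pow_one]⟩

end PExtensions

/-! ### Descent of Kummer extensions from K(ε) to K. -/

section KummerDescent

/-- Schur–Zassenhaus provides a complement of `P`; since `P` is central, conjugation by G reduces to
conjugation by the complement itself, which is therefore normal. -/
theorem Subgroup.exists_normal_index_eq_of_central {G : Type*} [Group G] [Finite G] {p : ℕ}
    (hp : p.Prime) {P : Subgroup G} (hP : P ≤ Subgroup.center G) (hcard : Nat.card P = p)
    (hindex : P.index < p) : ∃ H : Subgroup G, H.Normal ∧ H.index = p ∧ Nat.card H < p := by
  have hn : P.Normal := ⟨fun n hn g ↦ by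
    rw [Subgroup.mem_center_iff.1 (hP hn) g, mul_inv_cancel_right]; exact hn⟩
  have hpos : 0 < P.index := Nat.pos_of_ne_zero Subgroup.index_ne_zero_of_finite
  obtain ⟨H, hH⟩ := Subgroup.exists_right_complement'_of_coprime (N := P) (by
    rw [hcard]
    exact Nat.coprime_of_lt_prime hpos.ne' hindex hp)
  refine ⟨H, ⟨fun h hh g ↦ ?_⟩, ?_, ?_⟩
  · obtain ⟨⟨a, b⟩, hab⟩ := hH.2 g
    simp only at hab
    have ha := Subgroup.mem_center_iff.1 (hP a.2)
    rw [← hab, mul_inv_rev, ← mul_assoc, mul_assoc (a : G), mul_assoc (a : G), ← ha,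
      mul_inv_cancel_right]
    exact H.mul_mem (H.mul_mem b.2 hh) (H.inv_mem b.2)
  · rw [hH.index_eq_card, hcard]
  · rwa [← hH.symm.index_eq_card]

variable {K Ks : Type*} [Field K] [Field Ks] [Algebra K Ks] {p : ℕ}

theorem AlgEquiv.apply_eq_of_mem_adjoin (g : Gal(Ks/K)) {S : Set Ks} (h : ∀ x ∈ S, g x = x)
    {x : Ks} (hx : x ∈ IntermediateField.adjoin K S) : g x = x := by
  have hle : IntermediateField.adjoin K S ≤
      IntermediateField.fixedField (Subgroup.zpowers g) := by
    rw [IntermediateField.adjoin_le_iff]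
    rintro y hy ⟨_, n, rfl⟩
    have hg : g ∈ MulAction.stabilizer Gal(Ks/K) y := h y hy
    exact Subgroup.zpow_mem _ hg n
  exact hle hx ⟨g, Subgroup.mem_zpowers g⟩

theorem IsPrimitiveRoot.autToPow_eq_one_iff [Fact p.Prime] {ε : Ks} (hε : IsPrimitiveRoot ε p)
    (g : Gal(Ks/K)) : hε.autToPow K g = 1 ↔ g ε = ε := by
  rw [← hε.autToPow_spec K g]
  constructor
  · intro hg
    rw [hg, Units.val_one, ZMod.val_one, pow_one]
  · intro hg
    have h1 : (hε.autToPow K g : ZMod p).val = 1 :=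
      hε.pow_inj (ZMod.val_lt _) (Fact.out (p := p.Prime)).one_lt (hg.trans (pow_one _).symm)
    exact Units.ext (ZMod.val_injective p (by rw [h1, Units.val_one, ZMod.val_one]))

variable {Γ₀ : Type*} [LinearOrderedCommGroupWithZero Γ₀]

/-- If `ε` is a primitive `p`-th root of unity and the class of `β ^ p ∈ K(ε)` modulo `p`-th powers
transforms under the Galois group in the same way as `ε`, then `K(ε, β)` is the compositum
of `K(ε)` and a Galois extension of `K` of degree `p`. -/
theorem exists_isGalois_finrank_eq_of_kummer [IsGalois K Ks] (hp : p.Prime) {ε β : Ks}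
    (hε : IsPrimitiveRoot ε p) (hβ : β ≠ 0)
    (h : ∀ g : Gal(Ks/K), ∃ s : ℕ, ∃ c ∈ K⟮ε⟯, g ε = ε ^ s ∧ g β ^ p * c ^ p = (β ^ p) ^ s)
    (hb : β ^ p ∈ K⟮ε⟯) (w : Valuation Ks Γ₀) {z : Ks}
    (hz : z ∈ IntermediateField.adjoin K {ε, β}) {k₀ : K} (hk₀ : w z ^ p = w (algebraMap K Ks k₀))
    (hz' : ∀ k : K, w z ≠ w (algebraMap K Ks k)) :
    ∃ L : IntermediateField K Ks, IsGalois K L ∧ Module.finrank K L = p ∧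
      ∃ y ∈ L, w y = w z := by
  have hfact : Fact p.Prime := ⟨hp⟩
  set M := IntermediateField.adjoin K {ε, β} with hM
  have hεM : ε ∈ M := IntermediateField.subset_adjoin K _ (by simp)
  have hβM : β ∈ M := IntermediateField.subset_adjoin K _ (by simp)
  have hEM : K⟮ε⟯ ≤ M := by
    rw [IntermediateField.adjoin_simple_le_iff]; exact hεM
  have hfd : FiniteDimensional K M :=
    IntermediateField.finiteDimensional_adjoin fun x _ ↦ Algebra.IsIntegral.isIntegral x
  -- Taking p-th roots in the hypothesis: `g β` equals β ^ s up to a p-th root of unity and a factor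
  -- from K(ε).
  have key : ∀ g : Gal(Ks/K), ∃ s i : ℕ, ∃ c ∈ K⟮ε⟯, c ≠ 0 ∧ g ε = ε ^ s ∧
      g β * c = ε ^ i * β ^ s := by
    intro g
    obtain ⟨s, c, hc, hs, hcp⟩ := h g
    have hc0 : c ≠ 0 := by
      rintro rfl
      rw [zero_pow hp.ne_zero, mul_zero] at hcp
      exact pow_ne_zero _ (pow_ne_zero _ hβ) hcp.symm
    obtain ⟨i, -, hi⟩ := hε.eq_pow_of_pow_eq_one (ξ := g β * c / β ^ s) (by
      rw [div_pow, mul_pow, hcp, ← pow_mul, ← pow_mul, mul_comm, div_self (pow_ne_zero _ hβ)])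
    exact ⟨s, i, c, hc, hc0, hs, by rw [hi, div_mul_cancel₀ _ (pow_ne_zero _ hβ)]⟩
  have hnormal : Normal K M := by
    rw [IntermediateField.normal_iff_forall_map_le']
    intro g
    rw [hM, IntermediateField.adjoin_map, IntermediateField.adjoin_le_iff]
    obtain ⟨s, i, c, hc, hc0, hs, hi⟩ := key g
    rintro _ ⟨x, rfl | rfl, rfl⟩
    · change g x ∈ M
      rw [hs]
      exact pow_mem hεM s
    · change g x ∈ M
      rw [← mul_div_cancel_right₀ (g x) hc0, hi]
      exact div_mem (mul_mem (pow_mem hεM i) (pow_mem hβM s)) (hEM hc)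
  have hgal : IsGalois K M := ⟨⟩
  have hlift : ∀ g : Gal(M/K), ∃ g' : Gal(Ks/K), ∀ x : M, g' x = g x := by
    intro g
    obtain ⟨g', rfl⟩ := AlgEquiv.restrictNormalHom_surjective (F := K) (K₁ := M) Ks g
    exact ⟨g', fun x ↦ (AlgEquiv.restrictNormal_commutes g' M x).symm⟩
  let εM : M := ⟨ε, hεM⟩
  let βM : M := ⟨β, hβM⟩
  have hprim : IsPrimitiveRoot εM p := IsPrimitiveRoot.of_map_of_injective (f := M.val)
    (by simpa [εM] using hε) M.val.injective
  have hβM0 : βM ≠ 0 := fun h ↦ hβ (congrArg Subtype.val h)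
  have hfix : ∀ g : Gal(M/K), g εM = εM → ∀ c ∈ K⟮ε⟯, ∀ hc : c ∈ M, g ⟨c, hc⟩ = ⟨c, hc⟩ := by
    intro g hg c hc hcM
    obtain ⟨g', hg'⟩ := hlift g
    apply Subtype.ext
    rw [← hg']
    exact g'.apply_eq_of_mem_adjoin (S := {ε})
      (by rintro x rfl; exact (hg' εM).trans (congrArg _ hg)) hc
  have hone : ∀ g : Gal(M/K), g εM = εM → g βM = βM → g = 1 := by
    intro g hg₁ hg₂
    obtain ⟨g', hg'⟩ := hlift g
    ext x
    rw [← hg']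
    refine g'.apply_eq_of_mem_adjoin (S := {ε, β}) ?_ x.2
    rintro x (rfl | rfl)
    · exact (hg' εM).trans (congrArg _ hg₁)
    · exact (hg' βM).trans (congrArg _ hg₂)
  have keyM : ∀ g : Gal(M/K), ∃ s i : ℕ, ∃ c : M, c ≠ 0 ∧
      (∀ g' : Gal(M/K), g' εM = εM → g' c = c) ∧
      g εM = εM ^ s ∧ g βM * c = εM ^ i * βM ^ s := by
    intro g
    obtain ⟨g', hg'⟩ := hlift g
    obtain ⟨s, i, c, hc, hc0, hs, hi⟩ := key g'
    refine ⟨s, i, ⟨c, hEM hc⟩, fun h ↦ hc0 (congrArg Subtype.val h),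
      fun g' hg' ↦ hfix g' hg' c hc _, ?_, ?_⟩
    · exact Subtype.ext ((hg' εM).symm.trans hs)
    · apply Subtype.ext
      change (g βM : Ks) * c = ε ^ i * β ^ s
      rw [← hg']
      exact hi
  let χ := hprim.autToPow K
  let P := χ.ker
  have hPmem : ∀ g : Gal(M/K), g ∈ P ↔ g εM = εM := fun g ↦
    MonoidHom.mem_ker.trans (hprim.autToPow_eq_one_iff g)
  have hPβ : ∀ g ∈ P, ∃ i < p, g βM = εM ^ i * βM := by
    intro g hg
    have hg' := hfix g ((hPmem g).1 hg) _ hb (pow_mem hβM p)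
    have hgp : (g βM) ^ p = βM ^ p := by
      rw [← map_pow]; exact hg'
    obtain ⟨i, hip, hi⟩ := hprim.eq_pow_of_pow_eq_one (ξ := g βM / βM) (by
      rw [div_pow, hgp, div_self (pow_ne_zero _ hβM0)])
    exact ⟨i, hip, by rw [hi, div_mul_cancel₀ _ hβM0]⟩
  have hindex : P.index < p := by
    rw [Subgroup.index_ker]
    calc Nat.card χ.range ≤ Nat.card (ZMod p)ˣ := Subgroup.card_le_card_group _
      _ = p - 1 := by rw [Nat.card_eq_fintype_card, ZMod.card_units]
      _ < p := Nat.sub_lt hp.pos one_pos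
  -- The ramified element `z` excludes β ∈ K(ε): it forces [M : K] ≥ p, whereas [K(ε) : K] < p.
  have hple : p ≤ Nat.card Gal(M/K) := by
    rw [IsGalois.card_aut_eq_finrank]
    exact (w.comap (algebraMap M Ks)).le_finrank_of_ne (y := ⟨z, hz⟩) hp hz' hk₀
  have hcard : Nat.card P = p := by
    choose i hip hi using hPβ
    have hle : Nat.card P ≤ p := by
      have hinj : Function.Injective fun g : P ↦ (⟨i g g.2, hip g g.2⟩ : Fin p) := by
        intro g g' hgg'
        have hgi : i g g.2 = i g' g'.2 := congrArg Fin.val hgg'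
        have hββ : (g : Gal(M/K)) βM = (g' : Gal(M/K)) βM := by rw [hi g g.2, hi g' g'.2, hgi]
        have : (g' : Gal(M/K))⁻¹ * g = 1 := by
          refine hone _ ((hPmem _).1 (P.mul_mem (P.inv_mem g'.2) g.2)) ?_
          rw [AlgEquiv.mul_apply, hββ]
          exact (g' : Gal(M/K)).symm_apply_apply _
        exact Subtype.ext (inv_mul_eq_one.1 this).symm
      simpa using Nat.card_le_card_of_injective _ hinj
    refine le_antisymm hle ?_
    have hne : P ≠ ⊥ := by
      intro hbot
      rw [hbot, Subgroup.index_bot] at hindex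
      omega
    obtain ⟨g, hg, hg1⟩ := P.ne_bot_iff_exists_ne_one.1 hne |>.elim fun g hg ↦
      (⟨g, g.2, fun h ↦ hg (Subtype.ext h)⟩ : ∃ g : Gal(M/K), g ∈ P ∧ g ≠ 1)
    have hpow : ∀ n : ℕ, (g ^ n) βM = (εM ^ i g hg) ^ n * βM := by
      intro n
      induction n with
      | zero => simp
      | succ n ih =>
        rw [pow_succ', AlgEquiv.mul_apply, ih, map_mul, map_pow, map_pow, (hPmem g).1 hg, hi g hg,
          pow_succ, mul_assoc]
    have hgp : g ^ p = 1 := by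
      refine hone _ ((hPmem _).1 (P.pow_mem hg p)) ?_
      rw [hpow, ← pow_mul, mul_comm (i g hg), pow_mul, hprim.pow_eq_one, one_pow, one_mul]
    have hord : orderOf (⟨g, hg⟩ : P) = p := by
      rw [Subgroup.orderOf_mk]
      exact orderOf_eq_prime hgp hg1
    exact Nat.le_of_dvd Nat.card_pos (hord ▸ orderOf_dvd_natCard _)
  -- Here the eigenspace condition is used: `g'` raises both ε and β to the power `s`, up to factors
  -- fixed by `P`, so it commutes with multiplication of β by a power of ε.
  have hcentral : P ≤ Subgroup.center Gal(M/K) := by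
    intro g hg
    rw [Subgroup.mem_center_iff]
    intro g'
    have hgε := (hPmem g).1 hg
    obtain ⟨j, -, hj⟩ := hPβ g hg
    obtain ⟨s, i, c, hc0, hc, hs, hi⟩ := keyM g'
    have hcomm : g⁻¹ * (g'⁻¹ * (g * g')) = 1 := by
      have e1 : (g * g') εM = (g' * g) εM := by
        rw [AlgEquiv.mul_apply, AlgEquiv.mul_apply, hgε, hs, map_pow, hgε]
      have e2 : (g * g') βM = (g' * g) βM := by
        apply mul_right_cancel₀ hc0
        rw [AlgEquiv.mul_apply, AlgEquiv.mul_apply, hj, map_mul, map_pow, hs, mul_assoc, hi]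
        conv_lhs => rw [← hc g hgε, ← map_mul, hi, map_mul, map_pow, map_pow, hgε, hj]
        ring
      have e3 : ∀ x, (g * g') x = (g' * g) x → (g⁻¹ * (g'⁻¹ * (g * g'))) x = x := by
        intro x hx
        rw [AlgEquiv.mul_apply, AlgEquiv.mul_apply, hx, ← AlgEquiv.mul_apply, ← AlgEquiv.mul_apply]
        simp
      exact hone _ (e3 _ e1) (e3 _ e2)
    rw [inv_mul_eq_one, eq_inv_mul_iff_mul_eq] at hcomm
    exact hcomm
  obtain ⟨H, hH, hHi, hHc⟩ := Subgroup.exists_normal_index_eq_of_central hp hcentral hcard hindex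
  let F := IntermediateField.fixedField H
  have hFgal : IsGalois K F := inferInstance
  have hFH : F.fixingSubgroup = H := IntermediateField.fixingSubgroup_fixedField H
  have hFfin : Module.finrank K F = p := by
    rw [IntermediateField.finrank_eq_fixingSubgroup_index, hFH, hHi]
  have hFM : Module.finrank F M < p := by
    rwa [← IsGalois.card_fixingSubgroup_eq_finrank, hFH]
  -- Otherwise the value of `z` would have order p modulo that of `F` too, forcing [M : F] ≥ p.
  have hyF : ∃ y : F, w z = w ((y : M) : Ks) := by
    by_contra! hne
    refine absurd ((w.comap (algebraMap M Ks)).le_finrank_of_ne (K := F) (y := ⟨z, hz⟩)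
      (k₀ := algebraMap K F k₀) hp hne ?_) (not_le.2 hFM)
    exact hk₀
  obtain ⟨y, hy⟩ := hyF
  refine ⟨IntermediateField.lift F, IsGalois.of_algEquiv (IntermediateField.liftAlgEquiv F), ?_,
    ((y : M) : Ks), (IntermediateField.mem_lift _).2 y.2, hy.symm⟩
  rw [← hFfin]
  exact (IntermediateField.liftAlgEquiv F).toLinearEquiv.finrank_eq.symm

end KummerDescent

/-! ### Tame ramification forces roots of unity in the residue field. -/

section Tame

variable {K L Γ₀ : Type*} [Field K] [Field L] [Algebra K L] [LinearOrderedCommGroupWithZero Γ₀]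
  (w : Valuation L Γ₀) {p : ℕ}

/-- Were `τ x` not in the maximal ideal, its inverse would be integral, and applying τ⁻¹ would make
x⁻¹ integral. Only one automorphism is involved, so that the lemma also serves for elements of a
decomposition group. -/
theorem Valuation.map_lt_one_of_symm_stable {τ : Gal(L/K)} (hw : ∀ x : L, w x ≤ 1 → w (τ⁻¹ x) ≤ 1)
    {x : L} (hx : w x < 1) : w (τ x) < 1 := by
  by_contra! h
  have hτ : τ x ≠ 0 := by
    intro h0
    simp [h0] at h
  have h1 : w (τ x)⁻¹ ≤ 1 := by
    rw [map_inv₀]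
    exact inv_le_one_of_one_le₀ h
  have h2 := hw _ h1
  rw [map_inv₀, map_inv₀, show τ⁻¹ (τ x) = x from τ.symm_apply_apply x] at h2
  have hx0 : 0 < w x := by
    rw [w.pos_iff]
    rintro rfl
    simp at hτ
  exact absurd ((inv_le_one₀ hx0).1 h2) (not_le.2 hx)

theorem Valuation.map_lt_one_of_stable (hw : ∀ (τ : Gal(L/K)) (x : L), w x ≤ 1 → w (τ x) ≤ 1)
    (τ : Gal(L/K)) {x : L} (hx : w x < 1) : w (τ x) < 1 :=
  w.map_lt_one_of_symm_stable (hw τ⁻¹) hx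

theorem Valuation.map_eq_one_of_stable (hw : ∀ (τ : Gal(L/K)) (x : L), w x ≤ 1 → w (τ x) ≤ 1)
    (τ : Gal(L/K)) {x : L} (hx : w x = 1) : w (τ x) = 1 := by
  refine le_antisymm (hw τ x hx.le) (not_lt.1 fun h ↦ ?_)
  have := w.map_lt_one_of_stable hw τ⁻¹ h
  rw [show τ⁻¹ (τ x) = x from τ.symm_apply_apply x, hx] at this
  exact lt_irrefl _ this

/-- A Galois extension of degree `p` that is totally ramified relative to a valuation of residue
characteristic different from `p` forces the residue field of `K` to contain a nontrivial `p`-th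
root of unity. -/
theorem Valuation.exists_pow_sub_one_lt_one [IsGalois K L] (hp : p.Prime)
    (hfin : Module.finrank K L = p)
    (hw : ∀ (τ : Gal(L/K)) (x : L), w x ≤ 1 → w (τ x) ≤ 1) (hwp : w (p : L) = 1)
    {y : L} (hy : ∀ k : K, w y ≠ w (algebraMap K L k)) {k₀ : K}
    (hk₀ : w y ^ p = w (algebraMap K L k₀)) :
    ∃ c : K, w (algebraMap K L c ^ p - 1) < 1 ∧ ¬ w (algebraMap K L c - 1) < 1 := by
  have hfd : FiniteDimensional K L := FiniteDimensional.of_finrank_pos (hfin ▸ hp.pos)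
  have hy0 : y ≠ 0 := by rintro rfl; exact hy 0 (by simp)
  have hwy0 : w y ≠ 0 := w.ne_zero_iff.2 hy0
  have hk00 : w (algebraMap K L k₀) ≠ 0 := hk₀ ▸ pow_ne_zero _ hwy0
  have hτy : ∀ τ : Gal(L/K), w (τ y) = w y := by
    intro τ
    have h1 : w (y ^ p / algebraMap K L k₀) = 1 := by
      rw [map_div₀, map_pow, hk₀, div_self hk00]
    have h2 := w.map_eq_one_of_stable hw τ h1
    rw [map_div₀, map_pow, AlgEquiv.commutes, map_div₀, map_pow, div_eq_one_iff_eq hk00,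
      ← hk₀] at h2
    exact (pow_left_inj₀ zero_le zero_le hp.ne_zero).1 h2
  have hres : ∀ τ : Gal(L/K), ∃ a : K, w (τ y / y - algebraMap K L a) < 1 := fun τ ↦
    w.exists_sub_lt_one hp hfin hy hk₀ (by rw [map_div₀, hτy, div_self hwy0])
  choose a ha using hres
  -- If all ratios τ y / y were congruent to 1, then Tr(y) / y would be congruent to p, a unit here,
  -- and `y` would have the value of its trace, which lies in K.
  have hex : ∃ τ, ¬ w (algebraMap K L (a τ) - 1) < 1 := by
    by_contra! hall
    have hsum : w (∑ τ : Gal(L/K), (τ y / y - 1)) < 1 := by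
      refine w.map_sum_lt one_ne_zero fun τ _ ↦ ?_
      rw [← sub_add_sub_cancel _ (algebraMap K L (a τ))]
      exact w.map_add_lt (ha τ) (hall τ)
    have hsum' : ∑ τ : Gal(L/K), (τ y / y - 1) = algebraMap K L (Algebra.trace K L y) / y - p := by
      rw [trace_eq_sum_automorphisms, Finset.sum_sub_distrib, Finset.sum_div, Finset.sum_const,
        Finset.card_univ, ← Nat.card_eq_fintype_card, IsGalois.card_aut_eq_finrank, hfin]
      simp
    rw [hsum'] at hsum
    have h1 : w (algebraMap K L (Algebra.trace K L y) / y) = 1 := by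
      rw [← hwp, ← sub_add_cancel (algebraMap K L (Algebra.trace K L y) / y) (p : L)]
      exact w.map_add_eq_of_lt_right (by rwa [hwp])
    rw [map_div₀, div_eq_one_iff_eq hwy0] at h1
    exact hy _ h1.symm
  obtain ⟨τ, hτ⟩ := hex
  refine ⟨a τ, ?_, hτ⟩
  have hva : w (algebraMap K L (a τ)) = 1 := by
    have h1 : w (τ y / y) = 1 := by rw [map_div₀, hτy, div_self hwy0]
    rw [← h1, ← sub_sub_cancel (τ y / y) (algebraMap K L (a τ))]
    exact w.map_sub_eq_of_lt_left (by rw [h1]; exact ha τ)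
  -- The residue of τ y / y is represented in K, hence fixed by τ, so it is multiplicative along
  -- powers of τ; n = p then gives (a τ) ^ p ≡ 1.
  have hpow : ∀ n : ℕ, w ((τ ^ n) y / y - algebraMap K L (a τ) ^ n) < 1 := by
    intro n
    induction n with
    | zero => simp [div_self hy0]
    | succ n ih =>
      have h1 := w.map_lt_one_of_stable hw τ ih
      rw [_root_.map_sub, map_div₀ τ, map_pow τ, AlgEquiv.commutes] at h1
      have hne : τ y ≠ 0 := (map_ne_zero τ).2 hy0
      have e : (τ ^ (n + 1)) y / y - algebraMap K L (a τ) ^ (n + 1) =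
          (τ ((τ ^ n) y) / τ y - algebraMap K L (a τ) ^ n) * (τ y / y) +
            algebraMap K L (a τ) ^ n * (τ y / y - algebraMap K L (a τ)) := by
        rw [pow_succ' τ, AlgEquiv.mul_apply]
        field_simp
        ring
      rw [e]
      refine w.map_add_lt ?_ ?_
      · rw [map_mul, map_div₀ w, hτy, div_self hwy0, mul_one]
        exact h1
      · rw [map_mul, map_pow, hva, one_pow, one_mul]
        exact ha τ
  have hτp : τ ^ p = 1 := by
    rw [← hfin, ← IsGalois.card_aut_eq_finrank K L]
    exact pow_card_eq_one'
  have := hpow p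
  rwa [hτp, AlgEquiv.one_apply, div_self hy0, w.map_sub_swap] at this

end Tame

/-! ### Values of differences of p-th roots of unity. -/

section Cyclotomic

variable {L Γ₀ : Type*} [Field L] [LinearOrderedCommGroupWithZero Γ₀] (w : Valuation L Γ₀) {p : ℕ}
  {ε : L}

theorem Valuation.map_primitiveRoot (hp : p.Prime) (hε : IsPrimitiveRoot ε p) : w ε = 1 := by
  have : w ε ^ p = 1 := by rw [← map_pow, hε.pow_eq_one, map_one]
  exact (pow_eq_one_iff_of_nonneg zero_le hp.ne_zero).1 this

theorem Valuation.map_natCast_le_one (n : ℕ) : w (n : L) ≤ 1 := by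
  induction n with
  | zero => simp
  | succ n ih => rw [Nat.cast_succ]; exact w.map_add_le ih (map_one w).le

theorem Valuation.map_pow_sub_one_le (hε : w ε ≤ 1) (n : ℕ) : w (ε ^ n - 1) ≤ w (ε - 1) := by
  rw [← geom_sum_mul, map_mul]
  refine mul_le_of_le_one_left' (w.map_sum_le fun i _ ↦ ?_)
  rw [map_pow]
  exact pow_le_one' hε i

/-- Each of ε and ε ^ n is a power of the other, and x - 1 divides every x ^ k - 1. -/
theorem Valuation.map_primitiveRoot_pow_sub_one (hp : p.Prime) (hε : IsPrimitiveRoot ε p) {n : ℕ}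
    (hn : ¬ p ∣ n) : w (ε ^ n - 1) = w (ε - 1) := by
  have h1 := w.map_primitiveRoot hp hε
  refine le_antisymm (w.map_pow_sub_one_le h1.le n) ?_
  have hcop : n.Coprime p := ((Nat.Prime.coprime_iff_not_dvd hp).2 hn).symm
  obtain ⟨m, -, hm⟩ := Nat.exists_mul_mod_eq_one_of_coprime hcop hp.one_lt
  have : (ε ^ n) ^ m = ε := by
    rw [← pow_mul, ← Nat.div_add_mod (n * m) p, hm, pow_add, pow_mul, hε.pow_eq_one, one_pow,
      one_mul, pow_one]
  conv_lhs => rw [← this]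
  exact w.map_pow_sub_one_le (by rw [map_pow, h1, one_pow]) m

/-- p = Φ_p(1) is the product of the p - 1 factors 1 - μ, all of the same value. -/
theorem Valuation.map_primitiveRoot_sub_one_pow (hp : p.Prime) (hε : IsPrimitiveRoot ε p) :
    w (ε - 1) ^ (p - 1) = w (p : L) := by
  have hfact : Fact p.Prime := ⟨hp⟩
  have h := Polynomial.eval_one_cyclotomic_prime (R := L) (p := p)
  have hprod : Polynomial.eval (1 : L) (Polynomial.cyclotomic p L) =
      ∏ μ ∈ primitiveRoots p L, (1 - μ) := by
    rw [Polynomial.cyclotomic_eq_prod_X_sub_primitiveRoots hε, Polynomial.eval_prod]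
    simp
  rw [← h, hprod, map_prod]
  rw [Finset.prod_congr rfl (g := fun _ ↦ w (ε - 1)), Finset.prod_const, hε.card_primitiveRoots,
    Nat.totient_prime hp]
  intro μ hμ
  rw [mem_primitiveRoots hp.pos] at hμ
  obtain ⟨i, hi, rfl⟩ := hε.eq_pow_of_pow_eq_one hμ.pow_eq_one
  rw [w.map_sub_swap]
  refine w.map_primitiveRoot_pow_sub_one hp hε fun hd ↦ ?_
  have h0 : i = 0 := Nat.eq_zero_of_dvd_of_lt hd hi
  rw [h0, pow_zero] at hμ
  exact hp.ne_one (hμ.unique IsPrimitiveRoot.one)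

/-- If `c` is a nontrivial `p`-th root of unity in the residue field, then some power of `c` is
close to `ε`. -/
theorem Valuation.exists_pow_sub_lt_one (hp : p.Prime) (hε : IsPrimitiveRoot ε p) {c : L}
    (hc : w (c ^ p - 1) < 1) (hc1 : ¬ w (c - 1) < 1) : ∃ j : ℕ, w (c ^ j - ε) < 1 := by
  have : NeZero p := ⟨hp.ne_zero⟩
  have hε1 := w.map_primitiveRoot hp hε
  have hcle : w c ≤ 1 := by
    by_contra! hlt
    have h1 : (1 : Γ₀) < w (c ^ p) := by rw [map_pow]; exact one_lt_pow₀ hlt hp.ne_zero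
    have h2 : w (c ^ p - 1) = w (c ^ p) := w.map_sub_eq_of_lt_left (by rwa [map_one])
    exact absurd hc (by rw [h2]; exact not_lt.2 h1.le)
  have hprod : c ^ p - 1 = ∏ μ ∈ Polynomial.nthRootsFinset p (1 : L), (c - μ) := by
    have := congrArg (Polynomial.eval c) (Polynomial.X_pow_sub_one_eq_prod hp.pos hε)
    simpa [Polynomial.eval_prod] using this
  obtain ⟨μ, hμ, hlt⟩ : ∃ μ ∈ Polynomial.nthRootsFinset p (1 : L), w (c - μ) < 1 := by
    by_contra! hall
    rw [hprod, map_prod] at hc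
    exact absurd hc (not_lt.2 (Finset.one_le_prod' hall))
  rw [Polynomial.mem_nthRootsFinset hp.pos] at hμ
  obtain ⟨i, hi, rfl⟩ := hε.eq_pow_of_pow_eq_one hμ
  have hi0 : ¬ p ∣ i := by
    intro hd
    have h0 : i = 0 := Nat.eq_zero_of_dvd_of_lt hd hi
    rw [h0, pow_zero] at hlt
    exact hc1 hlt
  obtain ⟨m, -, hm⟩ := Nat.exists_mul_mod_eq_one_of_coprime
    ((Nat.Prime.coprime_iff_not_dvd hp).2 hi0).symm hp.one_lt
  have hεm : (ε ^ i) ^ m = ε := by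
    rw [← pow_mul, ← Nat.div_add_mod (i * m) p, hm, pow_add, pow_mul, hε.pow_eq_one, one_pow,
      one_mul, pow_one]
  refine ⟨m, ?_⟩
  conv_lhs => rw [← hεm]
  rw [← (Commute.all c (ε ^ i)).mul_geom_sum₂ m, map_mul]
  refine mul_lt_one_of_nonneg_of_lt_one_left zero_le hlt (w.map_sum_le fun k _ ↦ ?_)
  rw [map_mul, map_pow, map_pow, map_pow, hε1, one_pow, one_pow, mul_one]
  exact pow_le_one' hcle k

end Cyclotomic

/-! ### Projection to the cyclotomic eigenspace of K(ε)ˣ modulo p-th powers. -/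

section TwistedProduct

variable {K Ks : Type*} [Field K] [Field Ks] [Algebra K Ks] {p : ℕ} [Fact p.Prime]
  {ε : Ks} (hε : IsPrimitiveRoot ε p)

variable (K) in
open Classical in
/-- The exponents `t` modulo `p` such that `ε ^ t` is conjugate to `ε` over `K`. -/
noncomputable def conjExponents : Finset (ZMod p)ˣ :=
  Finset.univ.filter (· ∈ (hε.autToPow K).range)

theorem mem_conjExponents {t : (ZMod p)ˣ} :
    t ∈ conjExponents K hε ↔ t ∈ (hε.autToPow K).range := by
  simp [conjExponents]

theorem one_mem_conjExponents : 1 ∈ conjExponents K hε :=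
  (mem_conjExponents hε).2 (one_mem _)

theorem card_conjExponents_eq_card_range :
    (conjExponents K hε).card = Nat.card (hε.autToPow K).range := by
  rw [← SetLike.coe_sort_coe, Nat.card_coe_set_eq, ← Set.ncard_coe_finset]
  congr 1
  ext t
  simp [mem_conjExponents]

theorem card_conjExponents [IsGalois K Ks] :
    (conjExponents K hε).card = Module.finrank K K⟮ε⟯ := by
  rw [card_conjExponents_eq_card_range, ← Subgroup.index_ker,
    IntermediateField.finrank_eq_fixingSubgroup_index]
  congr 1
  ext g
  rw [MonoidHom.mem_ker, hε.autToPow_eq_one_iff, IntermediateField.mem_fixingSubgroup_iff]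
  constructor
  · intro h x hx
    exact g.apply_eq_of_mem_adjoin (S := {ε}) (by rintro x rfl; exact h) hx
  · intro h
    exact h ε (IntermediateField.mem_adjoin_simple_self K ε)

theorem not_dvd_card_conjExponents : ¬ p ∣ (conjExponents K hε).card := by
  have hp : p.Prime := Fact.out
  rw [card_conjExponents_eq_card_range]
  intro h
  have h1 := h.trans (Subgroup.card_subgroup_dvd_card _)
  rw [Nat.card_eq_fintype_card, ZMod.card_units] at h1
  exact absurd (Nat.le_of_dvd (Nat.sub_pos_of_lt hp.one_lt) h1)
    (not_le.2 (Nat.sub_lt hp.pos one_pos))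

theorem IsPrimitiveRoot.pow_val_mul {ε : Ks} (hε : IsPrimitiveRoot ε p) (s t : ZMod p) :
    ε ^ (s * t).val = (ε ^ s.val) ^ t.val := by
  rw [ZMod.val_mul, ← pow_mul]
  conv_rhs => rw [← Nat.mod_add_div (s.val * t.val) p, pow_add, pow_mul, hε.pow_eq_one, one_pow,
    mul_one]

theorem prod_conjExponents_map {M : Type*} [CommMonoid M] (F : (ZMod p)ˣ → M) (g : Gal(Ks/K)) :
    ∏ t ∈ conjExponents K hε, F (hε.autToPow K g * t) = ∏ t ∈ conjExponents K hε, F t := by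
  refine Finset.prod_bij' (fun t _ ↦ hε.autToPow K g * t)
    (fun t _ ↦ (hε.autToPow K g)⁻¹ * t) ?_ ?_ ?_ ?_ ?_
  · intro t ht
    rw [mem_conjExponents] at ht ⊢
    exact mul_mem ⟨g, rfl⟩ ht
  · intro t ht
    rw [mem_conjExponents] at ht ⊢
    exact mul_mem (inv_mem ⟨g, rfl⟩) ht
  · intro t _; simp
  · intro t _; simp
  · intro t _; rfl

variable {f : Ks → Ks}

theorem map_apply_pow_val (hf : ∀ (g : Gal(Ks/K)) x, g (f x) = f (g x)) (g : Gal(Ks/K))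
    (t : (ZMod p)ˣ) :
    g (f (ε ^ (t : ZMod p).val)) =
      f (ε ^ ((hε.autToPow K g * t : (ZMod p)ˣ) : ZMod p).val) := by
  rw [hf, map_pow, ← hε.autToPow_spec K g, Units.val_mul, hε.pow_val_mul]

theorem prod_conj_mem_range [IsGalois K Ks] (hf : ∀ (g : Gal(Ks/K)) x, g (f x) = f (g x)) :
    ∃ k : K, algebraMap K Ks k = ∏ t ∈ conjExponents K hε, f (ε ^ (t : ZMod p).val) := by
  have := (InfiniteGalois.mem_range_algebraMap_iff_fixed
    (∏ t ∈ conjExponents K hε, f (ε ^ (t : ZMod p).val)) (k := K)).2 fun g ↦ by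
      rw [map_prod, Finset.prod_congr rfl fun t _ ↦ map_apply_pow_val hε hf g t]
      exact prod_conjExponents_map hε (fun t ↦ f (ε ^ (t : ZMod p).val)) g
  exact this

variable (K f) in
/-- The projection of `f ε` to the eigenspace of `K(ε)ˣ / p` on which the Galois group acts in the
same way as on `ε`. -/
noncomputable def twistedProd : Ks :=
  ∏ t ∈ conjExponents K hε, f (ε ^ (t : ZMod p).val) ^ ((t⁻¹ : (ZMod p)ˣ) : ZMod p).val

/-- If g ε = ε ^ s, then `g` moves the factor at t to the one at s t; after reindexing, the exponent
t⁻¹ has become t⁻¹ s. The factor `c` collects the multiples of p lost when t⁻¹ s is reduced modulo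
p. -/
theorem map_twistedProd (hf : ∀ (g : Gal(Ks/K)) x, g (f x) = f (g x))
    (hfE : ∀ x ∈ K⟮ε⟯, f x ∈ K⟮ε⟯) (g : Gal(Ks/K)) :
    ∃ s : ℕ, ∃ c ∈ K⟮ε⟯, g ε = ε ^ s ∧
      g (twistedProd K hε f) * c ^ p = twistedProd K hε f ^ s := by
  have hmem : ∀ n : ℕ, f (ε ^ n) ∈ K⟮ε⟯ := fun n ↦
    hfE _ (pow_mem (IntermediateField.mem_adjoin_simple_self K ε) n)
  set s := hε.autToPow K g with hs
  refine ⟨(s : ZMod p).val, ∏ t ∈ conjExponents K hε, f (ε ^ (t : ZMod p).val) ^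
    ((((t⁻¹ : (ZMod p)ˣ) : ZMod p).val * (s : ZMod p).val) / p),
    prod_mem fun t _ ↦ pow_mem (hmem _) _, (hε.autToPow_spec K g).symm, ?_⟩
  have h1 : g (twistedProd K hε f) = ∏ t ∈ conjExponents K hε, f (ε ^ (t : ZMod p).val) ^
      ((t⁻¹ * s : (ZMod p)ˣ) : ZMod p).val := by
    rw [← prod_conjExponents_map hε _ g, twistedProd, map_prod]
    refine Finset.prod_congr rfl fun t _ ↦ ?_
    rw [map_pow, map_apply_pow_val hε hf, ← hs, mul_inv_rev, inv_mul_cancel_right]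
  rw [h1, twistedProd, ← Finset.prod_pow, ← Finset.prod_pow, ← Finset.prod_mul_distrib]
  refine Finset.prod_congr rfl fun t _ ↦ ?_
  rw [Units.val_mul, ZMod.val_mul, ← pow_mul, ← pow_mul, ← pow_add, mul_comm _ p, Nat.mod_add_div]

theorem twistedProd_mem (hfE : ∀ x ∈ K⟮ε⟯, f x ∈ K⟮ε⟯) : twistedProd K hε f ∈ K⟮ε⟯ :=
  prod_mem fun _ _ ↦
    pow_mem (hfE _ (pow_mem (IntermediateField.mem_adjoin_simple_self K ε) _)) _

end TwistedProduct

/-! ### Ramified extensions of degree p in characteristic 0. -/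

section Constructions

variable {K Ks Γ₀ : Type*} [Field K] [Field Ks] [Algebra K Ks]
  [LinearOrderedCommGroupWithZero Γ₀] {p : ℕ} [Fact p.Prime]

variable (K) in
/-- There is a Galois extension of `K` of degree `p` with an element whose value has order `p`
modulo the value group of `K`. -/
def HasRamifiedExtension (w : Valuation Ks Γ₀) (p : ℕ) : Prop :=
  ∃ L : IntermediateField K Ks, IsGalois K L ∧ Module.finrank K L = p ∧
    ∃ y ∈ L, (∀ k : K, w y ≠ w (algebraMap K Ks k)) ∧ ∃ k₀ : K, w y ^ p = w (algebraMap K Ks k₀)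

variable {ε : Ks}

/-- The ramified value may be carried by any `z` in K(ε, β); below it is β itself or a power of β -
1. -/
theorem hasRamifiedExtension_of_twistedProd (hε : IsPrimitiveRoot ε p) (w : Valuation Ks Γ₀)
    [IsGalois K Ks] {f : Ks → Ks}
    (hf : ∀ (g : Gal(Ks/K)) x, g (f x) = f (g x)) (hfE : ∀ x ∈ K⟮ε⟯, f x ∈ K⟮ε⟯) {β z : Ks}
    (hβ : β ^ p = twistedProd K hε f) (hβ0 : β ≠ 0)
    (hz : z ∈ IntermediateField.adjoin K {ε, β}) {k₀ : K} (hk₀ : w z ^ p = w (algebraMap K Ks k₀))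
    (hne : ∀ k : K, w (algebraMap K Ks k₀) ≠ w (algebraMap K Ks k) ^ p) :
    HasRamifiedExtension K w p := by
  have hne' : ∀ k : K, w z ≠ w (algebraMap K Ks k) := fun k h ↦ hne k (by rw [← hk₀, h])
  obtain ⟨L, hL, hfin, y, hyL, hy⟩ := exists_isGalois_finrank_eq_of_kummer (Fact.out) hε hβ0
    (fun g ↦ by
      rw [hβ, ← map_pow, hβ]
      exact map_twistedProd hε hf hfE g) (hβ ▸ twistedProd_mem hε hfE) w hz hk₀ hne'
  exact ⟨L, hL, hfin, y, hyL, fun k ↦ hy ▸ hne' k, k₀, by rw [hy, hk₀]⟩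

theorem Valuation.map_natCast_eq_one (w : Valuation Ks Γ₀) (hwp : w (p : Ks) < 1)
    {n : ℕ} (hn : ¬ p ∣ n) : w (n : Ks) = 1 := by
  refine le_antisymm (w.map_natCast_le_one n) (not_lt.1 fun hlt ↦ ?_)
  have hcop : IsCoprime (n : ℤ) p := by
    rw [Nat.isCoprime_iff_coprime]
    exact (((Fact.out : p.Prime).coprime_iff_not_dvd).2 hn).symm
  obtain ⟨u, v, huv⟩ := hcop
  have hle : ∀ i : ℤ, w (i : Ks) ≤ 1 := by
    intro i
    obtain ⟨m, rfl | rfl⟩ := i.eq_nat_or_neg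
    · exact_mod_cast w.map_natCast_le_one m
    · rw [Int.cast_neg, w.map_neg]
      exact_mod_cast w.map_natCast_le_one m
  have h1 : (u : Ks) * n + v * p = 1 := by exact_mod_cast congrArg (Int.cast (R := Ks)) huv
  have h2 : w ((u : Ks) * n + v * p) < 1 := by
    refine w.map_add_lt ?_ ?_
    · rw [map_mul, mul_comm]; exact mul_lt_one_of_nonneg_of_lt_one_left zero_le hlt (hle u)
    · rw [map_mul, mul_comm]; exact mul_lt_one_of_nonneg_of_lt_one_left zero_le hwp (hle v)
  rw [h1, map_one] at h2
  exact lt_irrefl _ h2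

theorem Valuation.map_sub_one_lt_one_of_primitiveRoot (w : Valuation Ks Γ₀)
    (hε : IsPrimitiveRoot ε p) (hwp : w (p : Ks) < 1) :
    w (ε - 1) < 1 := by
  by_contra! h
  rw [← w.map_primitiveRoot_sub_one_pow Fact.out hε] at hwp
  exact absurd hwp (not_lt.2 (one_le_pow_of_one_le' h _))

section FirstOrder

variable {w : Valuation Ks Γ₀} {e : Ks}

/-- Arithmetic of 1 + k e modulo elements of value below w(e): products add the coefficients, the
term in e ^ 2 being negligible. -/
theorem Valuation.first_order_mul (he : w e < 1) (he0 : e ≠ 0) {x y : Ks} {k l : ℕ}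
    (hx : w (x - (1 + k * e)) < w e) (hy : w (y - (1 + l * e)) < w e) :
    w (x * y - (1 + (k + l : ℕ) * e)) < w e := by
  have hlin : ∀ n : ℕ, w (1 + n * e) ≤ 1 := fun n ↦ by
    refine w.map_add_le (map_one w).le ?_
    rw [map_mul]
    exact mul_le_one' (w.map_natCast_le_one n) he.le
  have hy1 : w y ≤ 1 := by
    rw [← sub_add_cancel y (1 + l * e)]
    exact w.map_add_le (hy.le.trans he.le) (hlin l)
  have e1 : x * y - (1 + (k + l : ℕ) * e) =
      (x - (1 + k * e)) * y + (y - (1 + l * e)) * (1 + k * e) + (k * l : ℕ) * (e * e) := by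
    push_cast
    ring
  have hpos : 0 < w e := w.pos_iff.2 he0
  rw [e1]
  refine w.map_add_lt (w.map_add_lt ?_ ?_) ?_
  · rw [map_mul]
    exact (mul_le_of_le_one_right' hy1).trans_lt hx
  · rw [map_mul]
    exact (mul_le_of_le_one_right' (hlin k)).trans_lt hy
  · rw [map_mul, map_mul]
    refine (mul_le_of_le_one_left' (w.map_natCast_le_one _)).trans_lt ?_
    exact mul_lt_of_lt_one_right hpos he

theorem Valuation.first_order_pow (he : w e < 1) (he0 : e ≠ 0) {x : Ks} {k : ℕ}
    (hx : w (x - (1 + k * e)) < w e) (n : ℕ) :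
    w (x ^ n - (1 + (n * k : ℕ) * e)) < w e := by
  induction n with
  | zero => simpa using w.pos_iff.2 he0
  | succ n ih =>
    rw [pow_succ, Nat.succ_mul]
    exact Valuation.first_order_mul he he0 ih hx

theorem Valuation.first_order_prod (he : w e < 1) (he0 : e ≠ 0) {ι : Type*} (s : Finset ι)
    {x : ι → Ks} (hx : ∀ i ∈ s, w (x i - (1 + (1 : ℕ) * e)) < w e) :
    w (∏ i ∈ s, x i - (1 + s.card * e)) < w e := by
  classical
  induction s using Finset.induction_on with
  | empty => simpa using w.pos_iff.2 he0
  | insert i s hi ih =>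
    rw [Finset.prod_insert hi, Finset.card_insert_of_notMem hi, add_comm s.card]
    exact Valuation.first_order_mul he he0 (hx i (Finset.mem_insert_self i s))
      (ih fun j hj ↦ hx j (Finset.mem_insert_of_mem hj))

end FirstOrder

/-- With e = (ε - 1)a, the conjugate at t is 1 + t e to first order, and its power t⁻¹ is 1 + e. The
product of all m of them is 1 + m e, and m is a unit. -/
theorem map_twistedProd_sub_one (hε : IsPrimitiveRoot ε p) (w : Valuation Ks Γ₀)
    (hwp : w (p : Ks) < 1) {a : Ks} (ha0 : a ≠ 0) (ha : w a ≤ 1) :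
    w (twistedProd K hε (fun x ↦ 1 + (x - 1) * a) - 1) = w ((ε - 1) * a) := by
  have hp : p.Prime := Fact.out
  have hε1 := w.map_primitiveRoot hp hε
  have hl := w.map_sub_one_lt_one_of_primitiveRoot hε hwp
  set e := (ε - 1) * a with he
  have he0 : e ≠ 0 := mul_ne_zero (sub_ne_zero.2 (hε.ne_one hp.one_lt)) ha0
  have hwe : 0 < w e := w.pos_iff.2 he0
  have he1 : w e < 1 := by
    rw [he, map_mul]
    exact mul_lt_one_of_nonneg_of_lt_one_left zero_le hl ha
  have hbase : ∀ n : ℕ, w ((1 + (ε ^ n - 1) * a) - (1 + n * e)) < w e := by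
    intro n
    have e1 : (1 + (ε ^ n - 1) * a) - (1 + n * e) = (∑ i ∈ Finset.range n, (ε ^ i - 1)) * e := by
      rw [← geom_sum_mul, he, Finset.sum_sub_distrib]
      simp only [Finset.sum_const, Finset.card_range, nsmul_eq_mul, mul_one]
      ring
    rw [e1, map_mul]
    refine mul_lt_of_lt_one_left hwe (lt_of_le_of_lt (w.map_sum_le fun i _ ↦ ?_) hl)
    exact w.map_pow_sub_one_le hε1.le i
  have hterm : ∀ t ∈ conjExponents K hε, w ((1 + (ε ^ (t : ZMod p).val - 1) * a) ^
      ((t⁻¹ : (ZMod p)ˣ) : ZMod p).val - (1 + (1 : ℕ) * e)) < w e := by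
    intro t _
    have h1 := Valuation.first_order_pow he1 he0 (hbase (t : ZMod p).val)
      ((t⁻¹ : (ZMod p)ˣ) : ZMod p).val
    have h2 : ((t⁻¹ : (ZMod p)ˣ) : ZMod p).val * (t : ZMod p).val % p = 1 := by
      rw [← ZMod.val_mul, ← Units.val_mul, inv_mul_cancel, Units.val_one, ZMod.val_one]
    rw [← Nat.mod_add_div (((t⁻¹ : (ZMod p)ˣ) : ZMod p).val * (t : ZMod p).val) p, h2] at h1
    -- The integer product of the representatives of t⁻¹ and t is 1 + p q, and p q e is negligible
    -- because w(p) < 1.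
    rw [← sub_add_sub_cancel _ (1 + ((1 + p * (((t⁻¹ : (ZMod p)ˣ) : ZMod p).val *
      (t : ZMod p).val / p) : ℕ) : Ks) * e)]
    refine w.map_add_lt h1 ?_
    rw [add_sub_add_left_eq_sub, ← sub_mul, map_mul, Nat.cast_add, add_sub_cancel_left,
      Nat.cast_mul, map_mul]
    exact mul_lt_of_lt_one_left hwe
      (mul_lt_one_of_nonneg_of_lt_one_left zero_le hwp (w.map_natCast_le_one _))
  have hprod := Valuation.first_order_prod he1 he0 _ hterm
  have hcard : w ((conjExponents K hε).card * e) = w e := by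
    rw [map_mul, w.map_natCast_eq_one hwp (not_dvd_card_conjExponents hε), one_mul]
  rw [← sub_sub] at hprod
  rw [← hcard] at hprod ⊢
  rw [← sub_add_cancel (twistedProd K hε (fun x ↦ 1 + (x - 1) * a) - 1)
    (((conjExponents K hε).card : Ks) * e)]
  exact w.map_add_eq_of_lt_right hprod

/-- The value of `β - 1` when `β ^ p` is not too close to `1`. -/
theorem Valuation.map_sub_one_pow_of_lt (w : Valuation Ks Γ₀)
    (hε : IsPrimitiveRoot ε p) {β : Ks}
    (h1 : w (β ^ p - 1) < 1) (h2 : w (ε - 1) ^ p < w (β ^ p - 1)) :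
    w (β - 1) ^ p = w (β ^ p - 1) := by
  have hp : p.Prime := Fact.out
  have hβ1 : w β = 1 := by
    have : w (β ^ p) = 1 := by
      rw [← sub_add_cancel (β ^ p) 1, w.map_add_eq_of_lt_right (by rwa [map_one]), map_one]
    rw [map_pow] at this
    exact (pow_eq_one_iff_of_nonneg zero_le hp.ne_zero).1 this
  set z := β - 1 with hz
  have hz1 : w z ≤ 1 := w.map_sub_le hβ1.le (map_one w).le
  obtain ⟨r, hr, hexp⟩ : ∃ r : Ks, w r ≤ w z ∧ β ^ p - 1 = z ^ p + p * r := by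
    have hexp := add_pow_prime_eq hp z 1
    rw [hz, sub_add_cancel, ← hz, one_pow, mul_one, mul_assoc] at hexp
    refine ⟨_, ?_, by rw [hexp, add_right_comm, add_sub_cancel_right]⟩
    rw [map_mul]
    refine mul_le_of_le_one_right' (w.map_sum_le fun k _ ↦ ?_)
    rw [one_pow, mul_one, map_mul, map_pow]
    exact mul_le_one' (pow_le_one' hz1 _) (w.map_natCast_le_one _)
  -- Otherwise both z ^ p and p r have value at most w(ε - 1) ^ p, since w(p) = w(ε - 1) ^ (p - 1).
  -- Above this threshold z ^ p dominates.
  have hlz : w (ε - 1) < w z := by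
    by_contra! hle
    refine absurd h2 (not_lt.2 ?_)
    rw [hexp]
    refine w.map_add_le ?_ ?_
    · rw [map_pow]; exact pow_le_pow_left' hle p
    · rw [map_mul, ← w.map_primitiveRoot_sub_one_pow hp hε]
      conv_rhs => rw [← Nat.sub_add_cancel hp.one_le, pow_succ]
      exact mul_le_mul_right (hr.trans hle) _
  have hlt : w (p * r) < w (z ^ p) := by
    rw [map_mul, map_pow, ← w.map_primitiveRoot_sub_one_pow hp hε]
    have hzpos : 0 < w z := lt_of_le_of_lt zero_le hlz
    calc w (ε - 1) ^ (p - 1) * w r ≤ w (ε - 1) ^ (p - 1) * w z := mul_le_mul_right hr _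
      _ < w z ^ (p - 1) * w z := by
        refine mul_lt_mul_of_pos_right ?_ hzpos
        exact pow_lt_pow_left₀ hlz zero_le (Nat.sub_ne_zero_of_lt hp.one_lt)
      _ = w z ^ p := by rw [← pow_succ, Nat.sub_add_cancel hp.one_le]
  rw [hexp, w.map_add_eq_of_lt_left hlt, map_pow]

/-- The condition w(p) < w(a) says exactly that w((ε - 1)a) exceeds w(ε - 1) ^ p, so (β - 1) ^ p has
the value of (ε - 1)a. Raising β - 1 to the power p - 1 replaces ε - 1, whose value need not lie in
v(K), by p. -/
theorem hasRamifiedExtension_of_lt (hε : IsPrimitiveRoot ε p) (w : Valuation Ks Γ₀)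
    [IsSepClosure K Ks] (hp0 : (p : K) ≠ 0) (hwp : w (p : Ks) < 1)
    {a : K} (ha : w (algebraMap K Ks a) ≤ 1) (hpa : w (p : Ks) < w (algebraMap K Ks a))
    (hne : ∀ k : K, w (algebraMap K Ks (p * a ^ (p - 1))) ≠ w (algebraMap K Ks k) ^ p) :
    HasRamifiedExtension K w p := by
  have hp : p.Prime := Fact.out
  have : IsSepClosed Ks := IsSepClosure.sep_closed K
  have : NeZero (p : Ks) := ⟨by
    rw [← map_natCast (algebraMap K Ks)]
    exact (map_ne_zero _).2 hp0⟩
  have ha0 : algebraMap K Ks a ≠ 0 := w.pos_iff.1 (lt_of_le_of_lt zero_le hpa)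
  set f : Ks → Ks := fun x ↦ 1 + (x - 1) * algebraMap K Ks a with hfdef
  obtain ⟨β, hβ⟩ := IsSepClosed.exists_pow_nat_eq (twistedProd K hε f) p
  have hval := map_twistedProd_sub_one (K := K) hε w hwp ha0 ha
  rw [← hfdef, ← hβ] at hval
  have hl := w.map_sub_one_lt_one_of_primitiveRoot hε hwp
  have hlp : 0 < w (ε - 1) := w.pos_iff.2 (sub_ne_zero.2 (hε.ne_one hp.one_lt))
  have hlt : w (β ^ p - 1) < 1 := by
    rw [hval, map_mul]
    exact mul_lt_one_of_nonneg_of_lt_one_left zero_le hl ha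
  have hz := w.map_sub_one_pow_of_lt hε hlt (by
    rw [hval, map_mul, ← Nat.sub_add_cancel hp.one_le, pow_succ, mul_comm,
      w.map_primitiveRoot_sub_one_pow hp hε]
    exact mul_lt_mul_of_pos_left hpa hlp)
  have hβ0 : β ≠ 0 := by
    rintro rfl
    rw [zero_pow hp.ne_zero, zero_sub, w.map_neg, map_one] at hlt
    exact lt_irrefl _ hlt
  have hβmem : β ∈ K⟮ε, β⟯ := IntermediateField.subset_adjoin K _ (by simp)
  refine hasRamifiedExtension_of_twistedProd hε w (f := f) (z := (β - 1) ^ (p - 1)) ?_ ?_ hβ hβ0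
    (pow_mem (sub_mem hβmem (one_mem _)) _) ?_ hne
  · intro g x
    simp [hfdef]
  · intro x hx
    exact add_mem (one_mem _) (mul_mem (sub_mem hx (one_mem _)) (algebraMap_mem _ a))
  · rw [map_pow, ← pow_mul, mul_comm, pow_mul, hz, hval, map_mul, mul_pow,
      w.map_primitiveRoot_sub_one_pow hp hε, map_mul (algebraMap K Ks), map_pow (algebraMap K Ks),
      map_natCast (algebraMap K Ks), map_mul, map_pow]

theorem map_pow_val_sub (hε : IsPrimitiveRoot ε p) (w : Valuation Ks Γ₀)
    {c : Ks} (hc : w (ε - c) < w (ε - 1)) {t : (ZMod p)ˣ} (ht : t ≠ 1) :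
    w (ε ^ (t : ZMod p).val - c) = w (ε - 1) := by
  have hp : p.Prime := Fact.out
  have hpos : 0 < (t : ZMod p).val := by
    rw [Nat.pos_iff_ne_zero, Ne, ZMod.val_eq_zero]
    exact t.ne_zero
  have h1 : w (ε ^ (t : ZMod p).val - ε) = w (ε - 1) := by
    have e1 : ε ^ (t : ZMod p).val - ε = ε * (ε ^ ((t : ZMod p).val - 1) - 1) := by
      rw [mul_sub, mul_one, ← pow_succ', Nat.sub_add_cancel hpos]
    rw [e1, map_mul, w.map_primitiveRoot hp hε, one_mul]
    refine w.map_primitiveRoot_pow_sub_one hp hε fun hd ↦ ht ?_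
    have h0 := Nat.eq_zero_of_dvd_of_lt hd ((Nat.sub_le _ _).trans_lt (ZMod.val_lt (t : ZMod p)))
    have hval : (t : ZMod p).val = 1 := by omega
    exact Units.ext (ZMod.val_injective p (by rw [hval, Units.val_one, ZMod.val_one]))
  rw [← sub_add_sub_cancel _ ε, w.map_add_eq_of_lt_left (by rwa [h1]), h1]

/-- Since c is closer to ε than the other conjugates are, only the factor t = 1 depends on c. -/
theorem prod_map_pow_val_sub (hε : IsPrimitiveRoot ε p) (w : Valuation Ks Γ₀)
    {c : Ks} (hc : w (ε - c) < w (ε - 1)) (n : (ZMod p)ˣ → ℕ) :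
    ∃ N : ℕ, ∏ t ∈ conjExponents K hε, w (ε ^ (t : ZMod p).val - c) ^ n t =
      w (ε - c) ^ n 1 * w (ε - 1) ^ N := by
  classical
  refine ⟨∑ t ∈ (conjExponents K hε).erase 1, n t, ?_⟩
  rw [← Finset.mul_prod_erase _ _ (one_mem_conjExponents hε), Units.val_one, ZMod.val_one, pow_one,
    ← Finset.prod_pow_eq_pow_sum]
  congr 1
  refine Finset.prod_congr rfl fun t ht ↦ ?_
  rw [map_pow_val_sub hε w hc (Finset.ne_of_mem_erase ht)]

theorem map_sub_one_eq_of_lt (w : Valuation Ks Γ₀) {c : Ks} (hc : w (ε - c) < w (ε - 1)) :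
    w (ε - 1) = w (c - 1) := by
  rw [← w.map_sub_eq_of_lt_left hc, sub_sub_sub_cancel_left]

/-- If `c ∈ K` is closer to `ε` than `1` is, then the value of `ε - c` is in the value group of
`K`. -/
theorem exists_map_sub_eq (hε : IsPrimitiveRoot ε p) (w : Valuation Ks Γ₀)
    [IsGalois K Ks] {c : K}
    (hc : w (ε - algebraMap K Ks c) < w (ε - 1)) :
    ∃ k : K, w (ε - algebraMap K Ks c) = w (algebraMap K Ks k) := by
  -- The norm of ε - c lies in K, and its value is that of ε - c times a power of w(ε - 1) = w(c -
  -- 1).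
  obtain ⟨k, hk⟩ := prod_conj_mem_range (K := K) hε (f := fun x ↦ x - algebraMap K Ks c)
    (fun g x ↦ by simp)
  obtain ⟨N, hN⟩ := prod_map_pow_val_sub (K := K) hε w hc fun _ ↦ 1
  simp only [pow_one] at hN
  rw [← map_prod, ← hk] at hN
  have hl := map_sub_one_eq_of_lt w hc
  have hne : w (ε - 1) ^ N ≠ 0 := pow_ne_zero _ (lt_of_le_of_lt zero_le hc).ne'
  refine ⟨k / (c - 1) ^ N, ?_⟩
  rw [map_div₀, map_div₀, map_pow, map_pow, map_sub (algebraMap K Ks), map_one, ← hl, hN,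
    mul_div_cancel_right₀ _ hne]

/-- In the twisted product ε - c has exponent 1 and the other factors contribute a power of w(ε -
1), a p-th power by `hk₁`; so w(β) ^ p equals w(g) up to p-th powers. -/
theorem hasRamifiedExtension_of_close (hε : IsPrimitiveRoot ε p) (w : Valuation Ks Γ₀)
    [IsSepClosure K Ks] (hp0 : (p : K) ≠ 0) {c g k₁ : K}
    (hc : w (ε - algebraMap K Ks c) < w (ε - 1))
    (hk₁ : w (ε - 1) = w (algebraMap K Ks k₁) ^ p)
    (hg : w (ε - algebraMap K Ks c) = w (algebraMap K Ks g))
    (hne : ∀ k : K, w (algebraMap K Ks g) ≠ w (algebraMap K Ks k) ^ p) :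
    HasRamifiedExtension K w p := by
  have hp : p.Prime := Fact.out
  have : IsSepClosed Ks := IsSepClosure.sep_closed K
  have : NeZero (p : Ks) := ⟨by
    rw [← map_natCast (algebraMap K Ks)]
    exact (map_ne_zero _).2 hp0⟩
  set f : Ks → Ks := fun x ↦ x - algebraMap K Ks c with hfdef
  obtain ⟨β, hβ⟩ := IsSepClosed.exists_pow_nat_eq (twistedProd K hε f) p
  obtain ⟨N, hN⟩ := prod_map_pow_val_sub (K := K) hε w hc
    fun t ↦ ((t⁻¹ : (ZMod p)ˣ) : ZMod p).val
  have hβp : w β ^ p = w (algebraMap K Ks g) * (w (algebraMap K Ks k₁) ^ p) ^ N := by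
    rw [← map_pow, hβ, twistedProd, map_prod]
    simp only [map_pow]
    rw [hN, inv_one, Units.val_one, ZMod.val_one, pow_one, hg, hk₁]
  have hk₁0 : w (algebraMap K Ks k₁) ≠ 0 := fun h ↦ by
    rw [hk₁, h, zero_pow hp.ne_zero] at hc
    exact not_lt_zero hc
  have hg0 : w (algebraMap K Ks g) ≠ 0 := fun h ↦ hne 0 (by
    rw [h, map_zero, map_zero, zero_pow hp.ne_zero])
  have hβ0 : β ≠ 0 := by
    rintro rfl
    rw [map_zero, zero_pow hp.ne_zero] at hβp
    exact mul_ne_zero hg0 (pow_ne_zero _ (pow_ne_zero _ hk₁0)) hβp.symm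
  refine hasRamifiedExtension_of_twistedProd hε w (f := f) (z := β) (k₀ := g * (k₁ ^ p) ^ N)
    ?_ ?_ hβ hβ0 (IntermediateField.subset_adjoin K _ (by simp)) ?_ ?_
  · intro g x
    simp [hfdef]
  · intro x hx
    exact sub_mem hx (algebraMap_mem _ c)
  · rw [hβp]
    simp only [map_mul, map_pow]
  · intro k hk
    apply hne (k / k₁ ^ N)
    simp only [map_mul, map_pow, map_div₀] at hk ⊢
    rw [div_pow, ← hk, ← pow_mul, ← pow_mul, mul_comm N p,
      mul_div_cancel_right₀ _ (pow_ne_zero _ hk₁0)]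

end Constructions

/-! ### Ramified Artin–Schreier extensions in characteristic p. -/

section ArtinSchreier

variable {K Ks Γ₀ : Type*} [Field K] [Field Ks] [Algebra K Ks]
  [LinearOrderedCommGroupWithZero Γ₀] {p : ℕ} [Fact p.Prime]

theorem hasRamifiedExtension_of_charP [CharP K p] [IsSepClosure K Ks] (w : Valuation Ks Γ₀) {a : K}
    (ha : 1 < w (algebraMap K Ks a))
    (hne : ∀ k : K, w (algebraMap K Ks a) ≠ w (algebraMap K Ks k) ^ p) :
    HasRamifiedExtension K w p := by
  have hp : p.Prime := Fact.out
  have : IsSepClosed Ks := IsSepClosure.sep_closed K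
  have : CharP Ks p := charP_of_injective_algebraMap (algebraMap K Ks).injective p
  obtain ⟨θ, hθ⟩ := IsSepClosed.exists_root_C_mul_X_pow_add_C_mul_X_add_C' p p 1 (-1)
    (-algebraMap K Ks a) dvd_rfl hp.two_le (neg_ne_zero.2 one_ne_zero)
  have hθ' : θ ^ p - θ = algebraMap K Ks a := by linear_combination hθ
  have hθ1 : 1 < w θ := by
    by_contra! hle
    refine absurd ha (not_lt.2 ?_)
    rw [← hθ']
    exact w.map_sub_le (by rw [map_pow]; exact pow_le_one' hle p) hle
  have hwθ : w θ ^ p = w (algebraMap K Ks a) := by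
    rw [← hθ', w.map_sub_eq_of_lt_left, map_pow]
    rw [map_pow]
    exact lt_self_pow₀ hθ1 hp.one_lt
  have hwne : ∀ k : K, w θ ≠ w (algebraMap K Ks k) := fun k hk ↦ hne k (by rw [← hwθ, hk])
  have hint : IsIntegral K θ := Algebra.IsIntegral.isIntegral θ
  have hmem : θ ∈ K⟮θ⟯ := IntermediateField.mem_adjoin_simple_self K θ
  have hfd : FiniteDimensional K K⟮θ⟯ := IntermediateField.adjoin.finiteDimensional hint
  have hnormal : Normal K K⟮θ⟯ := by
    rw [IntermediateField.normal_iff_forall_map_le']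
    intro g
    rw [IntermediateField.adjoin_map, IntermediateField.adjoin_le_iff]
    rintro _ ⟨x, rfl, rfl⟩
    change g x ∈ K⟮x⟯
    have hg : (g x - x) ^ p = g x - x := by
      have := congrArg g hθ'
      rw [map_sub, map_pow, AlgEquiv.commutes, ← hθ'] at this
      rw [sub_pow_char]
      linear_combination this
    -- The conjugates of θ differ by solutions of t ^ p = t, that is, by elements of the prime
    -- field.
    have hle : (⊥ : Subfield Ks) ≤ K⟮x⟯.toSubfield := bot_le
    rw [← sub_add_cancel (g x) x]
    exact add_mem (hle ((Subfield.mem_bot_iff_pow_eq_self Ks p).2 hg)) hmem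
  refine ⟨K⟮θ⟯, ⟨⟩, le_antisymm ?_ ?_, θ, hmem, hwne, a, hwθ⟩
  · rw [IntermediateField.adjoin.finrank hint]
    have hpoly : (Polynomial.X ^ p - (Polynomial.X + Polynomial.C a) : Polynomial K).natDegree =
        p := by
      rw [Polynomial.natDegree_sub_eq_left_of_natDegree_lt, Polynomial.natDegree_X_pow]
      rw [Polynomial.natDegree_X_pow, Polynomial.natDegree_X_add_C]
      exact hp.one_lt
    conv_rhs => rw [← hpoly]
    refine Polynomial.natDegree_le_of_dvd (minpoly.dvd K θ ?_) ?_
    · simp only [map_sub, map_add, map_pow, Polynomial.aeval_X, Polynomial.aeval_C]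
      linear_combination hθ'
    · intro h
      rw [h, Polynomial.natDegree_zero] at hpoly
      exact hp.ne_zero hpoly.symm
  · exact (w.comap (algebraMap K⟮θ⟯ Ks)).le_finrank_of_ne (y := ⟨θ, hmem⟩) hp hwne hwθ

end ArtinSchreier

/-- Every valuation ring of a field extends to a given extension field. -/
theorem ValuationSubring.exists_comap_eq {F M : Type*} [Field F] [Field M] (φ : F →+* M)
    (A : ValuationSubring F) : ∃ B : ValuationSubring M, B.comap φ = A := by
  obtain ⟨B, hB⟩ := (A.toLocalSubring.map φ).exists_le_valuationSubring
  obtain ⟨hle, hloc⟩ := hB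
  have hAB : ∀ x ∈ A, φ x ∈ B := fun x hx ↦ hle ⟨x, hx, rfl⟩
  refine ⟨B, le_antisymm (fun x hx ↦ ?_) fun x hx ↦ hAB x hx⟩
  by_contra hxA
  have hx0 : x ≠ 0 := by rintro rfl; exact hxA A.zero_mem
  have hinv : x⁻¹ ∈ A := (A.mem_or_inv_mem x).resolve_left hxA
  -- φ(x⁻¹) is a unit in `B`, hence already in the image of `A`, since `B` dominates that local
  -- ring.
  have hu : IsUnit (⟨φ x⁻¹, ⟨x⁻¹, hinv, rfl⟩⟩ : (A.toLocalSubring.map φ).toSubring) := by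
    apply hloc.1
    refine IsUnit.of_mul_eq_one (⟨φ x, hx⟩ : B.toSubring) (Subtype.ext ?_)
    change φ x⁻¹ * φ x = 1
    rw [← map_mul, inv_mul_cancel₀ hx0, map_one]
  obtain ⟨⟨_, y, hy, rfl⟩, hxy⟩ := hu.exists_right_inv
  have h1 : φ x⁻¹ * φ y = 1 := congrArg Subtype.val hxy
  rw [← map_mul, map_eq_one_iff φ φ.injective] at h1
  rw [inv_mul_eq_one₀ hx0] at h1
  exact hxA (h1 ▸ hy)

/-! ### Isolated subgroups of ordered abelian groups. -/

section OrderedGroup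

variable {A : Type*} [CommGroup A] [LinearOrder A]

theorem subset_isolatedHull (S : Set A) : S ⊆ isolatedHull S := fun _ hx ↦
  Subgroup.mem_sInf.2 fun _ hH ↦ hH.2 hx

theorem isolatedHull_ordConnected (S : Set A) : (isolatedHull S : Set A).OrdConnected := by
  refine ⟨fun x hx y hy z hz ↦ Subgroup.mem_sInf.2 fun H hH ↦ ?_⟩
  exact hH.1.out (Subgroup.mem_sInf.1 hx H hH) (Subgroup.mem_sInf.1 hy H hH) hz

variable [IsOrderedMonoid A]

/-- An element of the isolated subgroup generated by a set of elements `≤ 1` is bounded by powers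
of a single element of the set. -/
theorem exists_pow_le_of_mem_isolatedHull {S : Set A} (hS : ∀ x ∈ S, x ≤ 1) {γ : A}
    (hγ : γ ∈ isolatedHull S) :
    ∃ π ∈ insert 1 S, ∃ n : ℕ, π ^ n ≤ γ ∧ γ ≤ (π ^ n)⁻¹ := by
  have hS' : ∀ x ∈ insert 1 S, x ≤ 1 := by
    rintro x (rfl | hx)
    exacts [le_rfl, hS x hx]
  -- These bounded elements form an isolated subgroup containing `S`. Inserting 1 covers the case of
  -- empty `S`.
  let H : Subgroup A :=
    { carrier := {γ | ∃ π ∈ insert 1 S, ∃ n : ℕ, π ^ n ≤ γ ∧ γ ≤ (π ^ n)⁻¹}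
      one_mem' := ⟨1, Set.mem_insert _ _, 0, by simp⟩
      inv_mem' := by
        rintro x ⟨π, hπ, n, h₁, h₂⟩
        exact ⟨π, hπ, n, le_inv'.1 h₂, inv_le_inv_iff.2 h₁⟩
      mul_mem' := by
        have key : ∀ π ∈ insert 1 S, ∀ ρ ∈ insert 1 S, π ≤ ρ → ∀ (n k : ℕ) (x y : A),
            π ^ n ≤ x ∧ x ≤ (π ^ n)⁻¹ → ρ ^ k ≤ y ∧ y ≤ (ρ ^ k)⁻¹ →
            ∃ π ∈ insert 1 S, ∃ n : ℕ, π ^ n ≤ x * y ∧ x * y ≤ (π ^ n)⁻¹ := by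
          intro π hπ ρ hρ hle n k x y hx hy
          have hk : π ^ k ≤ ρ ^ k := pow_le_pow_left' hle k
          refine ⟨π, hπ, n + k, ?_, ?_⟩
          · rw [pow_add]
            exact mul_le_mul' hx.1 (hk.trans hy.1)
          · rw [pow_add, mul_inv]
            exact mul_le_mul' hx.2 (hy.2.trans (inv_le_inv_iff.2 hk))
        rintro x y ⟨π, hπ, n, hx⟩ ⟨ρ, hρ, k, hy⟩
        rcases le_total π ρ with h | h
        · exact key π hπ ρ hρ h n k x y hx hy
        · rw [mul_comm x y]
          exact key ρ hρ π hπ h k n y x hy hx }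
  refine Subgroup.mem_sInf.1 hγ H ⟨⟨?_⟩, ?_⟩
  · rintro x ⟨π, hπ, n, hx⟩ y ⟨ρ, hρ, k, hy⟩ z hz
    rcases le_total π ρ with h | h
    · refine ⟨π, hπ, n + k, ?_, ?_⟩
      · refine le_trans ?_ (hx.1.trans hz.1)
        exact pow_le_pow_right_of_le_one' (hS' π hπ) (Nat.le_add_right n k)
      · refine hz.2.trans (hy.2.trans (inv_le_inv_iff.2 ?_))
        exact (pow_le_pow_right_of_le_one' (hS' π hπ) (Nat.le_add_left k n)).trans
          (pow_le_pow_left' h k)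
    · refine ⟨ρ, hρ, n + k, ?_, ?_⟩
      · refine le_trans ?_ (hx.1.trans hz.1)
        exact (pow_le_pow_right_of_le_one' (hS' ρ hρ) (Nat.le_add_right n k)).trans
          (pow_le_pow_left' h n)
      · refine hz.2.trans (hy.2.trans (inv_le_inv_iff.2 ?_))
        exact pow_le_pow_right_of_le_one' (hS' ρ hρ) (Nat.le_add_left k n)
  · intro x hx
    refine ⟨x, Set.mem_insert_of_mem _ hx, 1, by simp, ?_⟩
    rw [pow_one]
    exact (hS x hx).trans (one_le_inv'.2 (hS x hx))

/-- Modulo `p`-th powers, an element bounded by powers of `π = η ^ p` has a representative strictly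
between `π` and `1`. -/
theorem exists_between_of_not_pow {p : ℕ} {π η γ : A} (hπ : η ^ p = π)
    (hγ : ∀ δ : A, δ ^ p ≠ γ) {n : ℕ} (h₁ : π ^ n ≤ γ) (h₂ : γ ≤ (π ^ n)⁻¹) (hπ1 : π < 1) :
    ∃ γ' : A, π < γ' ∧ γ' < 1 ∧ ∀ δ : A, δ ^ p ≠ γ' := by
  classical
  set x := γ * π ^ n with hx
  have hx1 : x ≤ 1 := by
    rw [hx, ← inv_mul_cancel (π ^ n)]
    exact mul_le_mul_left h₂ _
  have hex : ∃ j : ℕ, π ^ j < x := by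
    refine ⟨n + n + 1, ?_⟩
    rw [pow_succ, pow_add]
    refine lt_of_lt_of_le (mul_lt_of_lt_one_right' _ hπ1) ?_
    exact mul_le_mul_left h₁ _
  have hj := Nat.find_spec hex
  have hmin := fun m ↦ Nat.find_min hex (m := m)
  set j := Nat.find hex
  have hj0 : j ≠ 0 := by
    intro h0
    rw [h0, pow_zero] at hj
    exact absurd hx1 (not_le.2 hj)
  obtain ⟨i, hi⟩ := Nat.exists_eq_succ_of_ne_zero hj0
  have hxi : x ≤ π ^ i := not_lt.1 (hmin i (by omega))
  have hnp : ∀ δ : A, δ ^ p ≠ x * (π ^ i)⁻¹ := by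
    intro δ hδ
    apply hγ (δ * η ^ i * (η ^ n)⁻¹)
    rw [mul_pow, mul_pow, inv_pow, ← pow_mul, ← pow_mul, mul_comm i, mul_comm n, pow_mul, pow_mul,
      hπ, hδ, hx, inv_mul_cancel_right, mul_inv_cancel_right]
  refine ⟨x * (π ^ i)⁻¹, ?_, ?_, hnp⟩
  · rw [lt_mul_inv_iff_mul_lt, ← pow_succ']
    rwa [hi] at hj
  · refine lt_of_le_of_ne ?_ fun h ↦ hnp 1 (by rw [one_pow, h])
    rwa [mul_inv_le_iff_le_mul, one_mul]

end OrderedGroup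

/-! ### Subgroups of the value group in terms of elements of K. -/

section ValueIn

variable {K Γ : Type*} [Field K] [LinearOrderedCommGroupWithZero Γ] (v : Valuation K Γ)

/-- The value of `x` lies in the subgroup `D` of the value group. -/
def ValueIn (D : Subgroup (ValGroup v)) (x : K) : Prop :=
  ∃ γ ∈ D, ((γ : Γˣ) : Γ) = v x

theorem ValGroup.exists_eq (γ : ValGroup v) : ∃ x : K, v x = ((γ : Γˣ) : Γ) :=
  v.exists_eq_of_mem_valueGroup γ.2

/-- The class of a nonzero element in the value group. -/
def ValGroup.mk {x : K} (hx : x ≠ 0) : ValGroup v :=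
  ⟨Units.mk0 (v x) (v.ne_zero_iff.2 hx), v.mem_valueGroup_of_eq (x := x) rfl⟩

theorem ValGroup.ext_iff' {γ δ : ValGroup v} :
    γ = δ ↔ ((γ : Γˣ) : Γ) = ((δ : Γˣ) : Γ) := by
  rw [Units.val_inj, Subtype.coe_inj]

variable {v} {D : Subgroup (ValGroup v)} {x y : K}

theorem ValueIn.ne_zero (hx : ValueIn v D x) : x ≠ 0 := by
  rintro rfl
  obtain ⟨γ, -, h⟩ := hx
  rw [map_zero] at h
  exact Units.ne_zero _ h

theorem valueIn_one : ValueIn v D 1 := ⟨1, D.one_mem, by simp⟩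

theorem ValueIn.mul (hx : ValueIn v D x) (hy : ValueIn v D y) : ValueIn v D (x * y) := by
  obtain ⟨γ, hγ, hx⟩ := hx
  obtain ⟨δ, hδ, hy⟩ := hy
  exact ⟨γ * δ, D.mul_mem hγ hδ, by rw [map_mul, ← hx, ← hy]; simp⟩

theorem ValueIn.inv (hx : ValueIn v D x) : ValueIn v D x⁻¹ := by
  obtain ⟨γ, hγ, hx⟩ := hx
  exact ⟨γ⁻¹, D.inv_mem hγ, by rw [map_inv₀, ← hx]; simp⟩

theorem ValueIn.pow (hx : ValueIn v D x) (n : ℕ) : ValueIn v D (x ^ n) := by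
  obtain ⟨γ, hγ, hx⟩ := hx
  exact ⟨γ ^ n, D.pow_mem hγ n, by rw [map_pow, ← hx]; simp⟩

theorem ValueIn.of_le (hD : (D : Set (ValGroup v)).OrdConnected) {z : K} (hx : ValueIn v D x)
    (hy : ValueIn v D y) (h₁ : v x ≤ v z) (h₂ : v z ≤ v y) : ValueIn v D z := by
  obtain ⟨γ, hγ, hx⟩ := hx
  obtain ⟨δ, hδ, hy⟩ := hy
  have hz : z ≠ 0 := by
    rintro rfl
    rw [map_zero, ← hx] at h₁
    exact Units.ne_zero _ (le_zero_iff.1 h₁)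
  refine ⟨ValGroup.mk v hz, hD.out hγ hδ ⟨?_, ?_⟩, rfl⟩
  · change ((γ : Γˣ) : Γ) ≤ v z
    rwa [hx]
  · change v z ≤ ((δ : Γˣ) : Γ)
    rwa [hy]

theorem IsPDivisible.exists_valueIn {p : ℕ} (hD : IsPDivisible p D) (hx : ValueIn v D x) :
    ∃ y : K, ValueIn v D y ∧ v y ^ p = v x := by
  obtain ⟨γ, hγ, hx⟩ := hx
  obtain ⟨δ, hδ, h⟩ := hD γ hγ
  obtain ⟨y, hy⟩ := ValGroup.exists_eq v δ
  exact ⟨y, ⟨δ, hδ, hy.symm⟩, by rw [hy, ← hx, ← h]; simp⟩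

/-- An isolated subgroup that is not `p`-divisible contains elements that are not divisible by `p`
in the whole value group. -/
theorem exists_not_pow_of_not_isPDivisible {A : Type*} [CommGroup A] [LinearOrder A]
    [IsOrderedMonoid A] {p : ℕ} (hp : p ≠ 0) {H : Subgroup A} (hH : (H : Set A).OrdConnected)
    (h : ¬ IsPDivisible p H) : ∃ γ ∈ H, ∀ δ : A, δ ^ p ≠ γ := by
  simp only [IsPDivisible, not_forall, not_exists, not_and] at h
  obtain ⟨γ, hγ, hne⟩ := h
  refine ⟨γ, hγ, fun δ hδ ↦ hne δ ?_ hδ⟩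
  rcases le_total δ 1 with h1 | h1
  · refine hH.out hγ H.one_mem ⟨?_, h1⟩
    rw [← hδ]
    rw [← Nat.sub_one_add_one hp, pow_succ]
    exact mul_le_of_le_one_left' (pow_le_one' h1 _)
  · refine hH.out H.one_mem hγ ⟨h1, ?_⟩
    rw [← hδ]
    rw [← Nat.sub_one_add_one hp, pow_succ]
    exact le_mul_of_one_le_left' (one_le_pow_of_one_le' h1 _)

end ValueIn

/-! ### Coarsening by an isolated subgroup, and the tame argument there. -/

section Coarsening

variable {K Ks Γ : Type*} [Field K] [Field Ks] [Algebra K Ks] [LinearOrderedCommGroupWithZero Γ]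
  {v : Valuation K Γ} {W : ValuationSubring Ks}

theorem ValuationSubring.isEquiv_of_comap_eq {F M Γ₀ : Type*} [Field F] [Field M]
    [LinearOrderedCommGroupWithZero Γ₀] {φ : F →+* M} {u : Valuation F Γ₀}
    {W : ValuationSubring M} (h : W.comap φ = u.valuationSubring) :
    (W.valuation.comap φ).IsEquiv u := by
  rw [Valuation.isEquiv_iff_valuationSubring, ← h]
  ext x
  rw [Valuation.mem_valuationSubring_iff, Valuation.comap_apply, W.valuation_le_one_iff,
    ValuationSubring.mem_comap]

theorem valuation_algebraMap_le_iff
    (hW : W.comap (algebraMap K Ks) = v.valuationSubring) (x y : K) :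
    W.valuation (algebraMap K Ks x) ≤ W.valuation (algebraMap K Ks y) ↔ v x ≤ v y :=
  ValuationSubring.isEquiv_of_comap_eq hW x y

theorem valuation_algebraMap_lt_iff
    (hW : W.comap (algebraMap K Ks) = v.valuationSubring) (x y : K) :
    W.valuation (algebraMap K Ks x) < W.valuation (algebraMap K Ks y) ↔ v x < v y := by
  rw [← not_le, ← not_le, valuation_algebraMap_le_iff hW]

theorem valuation_algebraMap_eq_iff
    (hW : W.comap (algebraMap K Ks) = v.valuationSubring) (x y : K) :
    W.valuation (algebraMap K Ks x) = W.valuation (algebraMap K Ks y) ↔ v x = v y :=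
  (ValuationSubring.isEquiv_of_comap_eq hW).eq_iff

theorem valuation_algebraMap_le_one_iff
    (hW : W.comap (algebraMap K Ks) = v.valuationSubring) (x : K) :
    W.valuation (algebraMap K Ks x) ≤ 1 ↔ v x ≤ 1 := by
  simpa using valuation_algebraMap_le_iff hW x 1

/-- The coarsening of the valuation ring `W` with respect to a subgroup of the value group of
`K`. -/
def coarsening (W : ValuationSubring Ks) (hW : W.comap (algebraMap K Ks) = v.valuationSubring)
    (D : Subgroup (ValGroup v)) : ValuationSubring Ks :=
  W.ofLE
    { carrier := {x | ∃ d : K, ValueIn v D d ∧ x * algebraMap K Ks d ∈ W}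
      zero_mem' := ⟨1, valueIn_one, by simp⟩
      one_mem' := ⟨1, valueIn_one, by simp⟩
      mul_mem' := by
        rintro x y ⟨d, hd, hx⟩ ⟨e, he, hy⟩
        refine ⟨d * e, hd.mul he, ?_⟩
        rw [map_mul, mul_mul_mul_comm]
        exact W.mul_mem _ _ hx hy
      neg_mem' := by
        rintro x ⟨d, hd, hx⟩
        exact ⟨d, hd, by rw [neg_mul]; exact W.neg_mem _ hx⟩
      add_mem' := by
        -- Of two denominators, the one of smaller value clears both summands.
        have key : ∀ (d e : K) (y : Ks), e ≠ 0 → v d ≤ v e → y * algebraMap K Ks e ∈ W →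
            y * algebraMap K Ks d ∈ W := by
          intro d e y he hde hy
          have hmem : algebraMap K Ks (d / e) ∈ W := by
            rw [← W.valuation_le_one_iff, valuation_algebraMap_le_one_iff hW, map_div₀]
            exact div_le_one_of_le₀ hde zero_le
          have := W.mul_mem _ _ hy hmem
          rwa [mul_assoc, ← map_mul, mul_div_cancel₀ _ he] at this
        rintro x y ⟨d, hd, hx⟩ ⟨e, he, hy⟩
        rcases le_total (v d) (v e) with h | h
        · refine ⟨d, hd, ?_⟩
          rw [add_mul]
          exact W.add_mem _ _ hx (key d e y he.ne_zero h hy)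
        · refine ⟨e, he, ?_⟩
          rw [add_mul]
          exact W.add_mem _ _ (key e d x hd.ne_zero h hx) hy }
    fun x hx ↦ ⟨1, valueIn_one, by simpa using hx⟩

variable {hW : W.comap (algebraMap K Ks) = v.valuationSubring} {D : Subgroup (ValGroup v)}

theorem mem_coarsening {x : Ks} :
    x ∈ coarsening W hW D ↔ ∃ d : K, ValueIn v D d ∧ x * algebraMap K Ks d ∈ W := Iff.rfl

theorem le_coarsening : W ≤ coarsening W hW D := fun x hx ↦
  ⟨1, valueIn_one, by simpa using hx⟩

theorem coarsening_valuation_mono {x y : Ks} (h : W.valuation x ≤ W.valuation y) :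
    (coarsening W hW D).valuation x ≤ (coarsening W hW D).valuation y := by
  rw [← W.mapOfLE_valuation_apply _ le_coarsening, ← W.mapOfLE_valuation_apply _ le_coarsening]
  exact W.monotone_mapOfLE _ le_coarsening h

theorem coarsening_valuation_congr {x y : Ks} (h : W.valuation x = W.valuation y) :
    (coarsening W hW D).valuation x = (coarsening W hW D).valuation y :=
  le_antisymm (coarsening_valuation_mono h.le) (coarsening_valuation_mono h.ge)

theorem lt_of_coarsening_valuation_lt {x y : Ks}
    (h : (coarsening W hW D).valuation x < (coarsening W hW D).valuation y) :
    W.valuation x < W.valuation y := by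
  by_contra! hle
  exact absurd h (not_lt.2 (coarsening_valuation_mono hle))

theorem coarsening_valuation_algebraMap {d : K} (hd : ValueIn v D d) :
    (coarsening W hW D).valuation (algebraMap K Ks d) = 1 := by
  have key : ∀ e : K, ValueIn v D e → (coarsening W hW D).valuation (algebraMap K Ks e) ≤ 1 := by
    intro e he
    rw [ValuationSubring.valuation_le_one_iff, mem_coarsening]
    refine ⟨e⁻¹, he.inv, ?_⟩
    rw [← map_mul, mul_inv_cancel₀ he.ne_zero, map_one]
    exact W.one_mem
  refine le_antisymm (key d hd) ?_
  have := key _ hd.inv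
  rw [map_inv₀, map_inv₀] at this
  have hpos : 0 < (coarsening W hW D).valuation (algebraMap K Ks d) := by
    rw [Valuation.pos_iff, Ne, map_eq_zero]
    exact hd.ne_zero
  exact (inv_le_one₀ hpos).1 this

/-- A unit d of the coarsening is bounded above by an element of `D`, and so is d⁻¹; convexity
places the value of d in `D`. -/
theorem valueIn_of_coarsening_valuation_eq_one (hD : (D : Set (ValGroup v)).OrdConnected) {d : K}
    (hd : (coarsening W hW D).valuation (algebraMap K Ks d) = 1) : ValueIn v D d := by
  have hd0 : d ≠ 0 := by
    rintro rfl
    simp at hd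
  have key : ∀ e : K, (coarsening W hW D).valuation (algebraMap K Ks e) = 1 →
      ∃ f : K, ValueIn v D f ∧ v e * v f ≤ 1 := by
    intro e he
    obtain ⟨f, hf, hmem⟩ := mem_coarsening.1 ((ValuationSubring.valuation_le_one_iff _ _).1 he.le)
    rw [← map_mul, ← W.valuation_le_one_iff, valuation_algebraMap_le_one_iff hW, map_mul] at hmem
    exact ⟨f, hf, hmem⟩
  obtain ⟨f, hf, h₁⟩ := key d hd
  obtain ⟨g, hg, h₂⟩ := key d⁻¹ (by rw [map_inv₀, map_inv₀, hd, inv_one])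
  refine ValueIn.of_le hD hg hf.inv ?_ ?_
  · have hpos : 0 < v d := v.pos_iff.2 hd0
    rw [map_inv₀] at h₂
    calc v g = v d * ((v d)⁻¹ * v g) := by rw [mul_inv_cancel_left₀ hpos.ne']
      _ ≤ v d * 1 := mul_le_mul_right h₂ _
      _ = v d := mul_one _
  · rw [map_inv₀]
    have hpos : 0 < v f := v.pos_iff.2 hf.ne_zero
    calc v d = v d * v f * (v f)⁻¹ := by rw [mul_inv_cancel_right₀ hpos.ne']
      _ ≤ 1 * (v f)⁻¹ := mul_le_mul_left h₁ _
      _ = (v f)⁻¹ := one_mul _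

variable {p : ℕ}

theorem ValuationSubring.valuation_eq_iff_of_eq {L Γ₀ : Type*} [Field L]
    [LinearOrderedCommGroupWithZero Γ₀] {B : ValuationSubring L} {u : Valuation L Γ₀}
    (h : B = u.valuationSubring) (x y : L) : B.valuation x = B.valuation y ↔ u x = u y := by
  subst h
  exact u.isEquiv_valuation_valuationSubring.symm.eq_iff

theorem valuationSubring_comap_algebraMap {L : IntermediateField K Ks} :
    W.comap (algebraMap L Ks) = (W.valuation.comap (algebraMap L Ks)).valuationSubring := by
  ext x
  rw [Valuation.mem_valuationSubring_iff, Valuation.comap_apply, W.valuation_le_one_iff,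
    ValuationSubring.mem_comap]

theorem comap_comap_algebraMap (hW : W.comap (algebraMap K Ks) = v.valuationSubring)
    (L : IntermediateField K Ks) :
    (W.comap (algebraMap L Ks)).comap (algebraMap K L) = v.valuationSubring := by
  rw [ValuationSubring.comap_comap, ← IsScalarTower.algebraMap_eq, hW]

/-- A ramified Galois extension of degree `p` is a totally ramified subextension of the maximal
`p`-extension. -/
theorem HasRamifiedExtension.exists_isTotallyRamified (hp : p.Prime)
    (hW : W.comap (algebraMap K Ks) = v.valuationSubring)
    (h : HasRamifiedExtension K W.valuation p) :
    ∃ L : IntermediateField K Ks, L ≤ maximalPExtension p K Ks ∧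
      Module.finrank K L = p ∧ IsTotallyRamified v L := by
  obtain ⟨L, hL, hfin, y, hy, hne, k₀, hk₀⟩ := h
  have hfd : FiniteDimensional K L := FiniteDimensional.of_finrank_pos (hfin ▸ hp.pos)
  refine ⟨L, le_maximalPExtension hfin, hfin, hfd, W.comap (algebraMap L Ks),
    comap_comap_algebraMap hW L, ?_⟩
  have hiff := ValuationSubring.valuation_eq_iff_of_eq
    (valuationSubring_comap_algebraMap (W := W) (L := L))
  refine Valuation.relIndex_eq_of_ne _ hp hfin (y := ⟨y, hy⟩) (k₀ := k₀) ?_ ?_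
  · intro k hk
    exact hne k ((hiff _ _).1 hk)
  · rw [← map_pow, hiff]
    exact (map_pow W.valuation y p).trans hk₀

/-- The p-Henselian property identifies the valuation ring witnessing total ramification with the
restriction of `W`. -/
theorem exists_ne_of_isTotallyRamified (hp : p.Prime)
    (hW : W.comap (algebraMap K Ks) = v.valuationSubring) (hHens : IsPHenselian v p Ks)
    {L : IntermediateField K Ks} (hL : L ≤ maximalPExtension p K Ks)
    (hfin : Module.finrank K L = p) (hTR : IsTotallyRamified v L) :
    ∃ y : L, (∀ k : K, W.valuation y ≠ W.valuation (algebraMap K Ks k)) ∧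
      ∃ k₀ : K, W.valuation y ^ p = W.valuation (algebraMap K Ks k₀) := by
  obtain ⟨-, B, hB, hindex⟩ := hTR
  have hBW : B = W.comap (algebraMap L Ks) :=
    (hHens L hL).unique hB (comap_comap_algebraMap hW L)
  have hiff := ValuationSubring.valuation_eq_iff_of_eq
    (hBW.trans (valuationSubring_comap_algebraMap (W := W) (L := L)))
  obtain ⟨y, hy, k₀, hk₀⟩ := B.valuation.exists_ne_of_relIndex_eq hp (hindex.trans hfin)
  refine ⟨y, fun k hk ↦ hy k ((hiff _ _).2 hk), k₀, ?_⟩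
  rw [← map_pow, hiff] at hk₀
  exact (map_pow W.valuation (y : Ks) p).symm.trans hk₀

/-- If `D` is a `p`-divisible isolated subgroup containing the value of `p` and a totally ramified
extension of degree `p` exists, then `K` contains elements arbitrarily close to `ε`, relative to
`D`. -/
theorem exists_coarsening_valuation_sub_lt_one [IsSepClosure K Ks] (hp : p.Prime)
    (hW : W.comap (algebraMap K Ks) = v.valuationSubring) (hHens : IsPHenselian v p Ks)
    {ε : Ks} (hε : IsPrimitiveRoot ε p)
    (hD : (D : Set (ValGroup v)).OrdConnected) (hDp : IsPDivisible p D)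
    (hpD : ValueIn v D (p : K)) {L : IntermediateField K Ks} (hL : L ≤ maximalPExtension p K Ks)
    (hfin : Module.finrank K L = p) (hTR : IsTotallyRamified v L) :
    ∃ c : K, (coarsening W hW D).valuation (ε - algebraMap K Ks c) < 1 := by
  obtain ⟨y, hy, k₀, hk₀⟩ := exists_ne_of_isTotallyRamified hp hW hHens hL hfin hTR
  have hgal := isGalois_of_le_maximalPExtension hp hL hfin
  set u := (coarsening W hW D).valuation with hu
  have hpow : ∀ (x : Ks) (k : K), W.valuation x ^ p = W.valuation (algebraMap K Ks k) →
      u x ^ p = u (algebraMap K Ks k) := by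
    intro x k hxk
    rw [← map_pow] at hxk ⊢
    exact coarsening_valuation_congr hxk
  -- If y and k agree in the coarsening, (y / k) ^ p has its value in `D`. As `D` is p-divisible, y
  -- / k has the value of some e in K, so y was not ramified.
  have hne : ∀ k : K, u y ≠ u (algebraMap K Ks k) := by
    intro k hk
    have hy0 : (y : Ks) ≠ 0 := by
      intro h0
      apply hy 0
      rw [h0, map_zero, map_zero, map_zero]
    have hk0 : u (algebraMap K Ks k) ≠ 0 := by
      rw [← hk]
      exact u.ne_zero_iff.2 hy0
    have hk0' : algebraMap K Ks k ≠ 0 := u.ne_zero_iff.1 hk0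
    have h1 : W.valuation (y / algebraMap K Ks k) ^ p =
        W.valuation (algebraMap K Ks (k₀ / k ^ p)) := by
      rw [map_div₀, div_pow, hk₀, map_div₀, map_div₀, map_pow, map_pow]
    have h2 := hpow _ _ h1
    rw [map_div₀, hk, div_self hk0, one_pow, eq_comm] at h2
    obtain ⟨e, -, he⟩ := hDp.exists_valueIn (valueIn_of_coarsening_valuation_eq_one hD h2)
    rw [← map_pow, ← valuation_algebraMap_eq_iff hW, ← h1, map_pow, map_pow] at he
    have h3 := (pow_left_inj₀ zero_le zero_le hp.ne_zero).1 he
    apply hy (e * k)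
    rw [map_mul, map_mul, h3, map_div₀, div_mul_cancel₀]
    exact W.valuation.ne_zero_iff.2 hk0'
  -- A conjugate of the valuation ring of `L` also extends `v`, hence equals it by uniqueness; the
  -- coarsening inherits the stability because τ fixes K.
  have hstable : ∀ (τ : Gal(L/K)) (x : L), u.comap (algebraMap L Ks) x ≤ 1 →
      u.comap (algebraMap L Ks) (τ x) ≤ 1 := by
    intro τ x hx
    have hτ : (W.comap (algebraMap L Ks)).comap (τ : L →+* L) = W.comap (algebraMap L Ks) := by
      refine (hHens L hL).unique ?_ (comap_comap_algebraMap hW L)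
      rw [← comap_comap_algebraMap hW L, ValuationSubring.comap_comap]
      congr 1
      ext x
      simp
    rw [Valuation.comap_apply, hu, ValuationSubring.valuation_le_one_iff, mem_coarsening] at hx ⊢
    obtain ⟨d, hd, hmem⟩ := hx
    refine ⟨d, hd, ?_⟩
    have hmem' : x * algebraMap K L d ∈ W.comap (algebraMap L Ks) := hmem
    rw [← hτ, ValuationSubring.mem_comap, ValuationSubring.mem_comap] at hmem'
    have e1 : (τ : L →+* L) (x * algebraMap K L d) = τ x * algebraMap K L d := by
      simp
    rw [e1] at hmem'
    exact hmem'
  have hup : u ((p : L) : Ks) = 1 := by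
    have := coarsening_valuation_algebraMap (W := W) (hW := hW) hpD
    rw [map_natCast] at this
    exact_mod_cast this
  obtain ⟨c, hc, hc1⟩ := (u.comap (algebraMap L Ks)).exists_pow_sub_one_lt_one hp hfin hstable hup
    (y := y) hne (hpow _ _ hk₀)
  have hc' : u (algebraMap K Ks c ^ p - 1) < 1 := hc
  have hc1' : ¬ u (algebraMap K Ks c - 1) < 1 := hc1
  obtain ⟨j, hj⟩ := u.exists_pow_sub_lt_one hp hε hc' hc1'
  refine ⟨c ^ j, ?_⟩
  rw [map_pow, u.map_sub_swap]
  exact hj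

end Coarsening

/-! ### The divisibility criteria for G(K) and Δ(v). -/

section Criteria

variable {K Ks Γ : Type*} [Field K] [Field Ks] [Algebra K Ks] [LinearOrderedCommGroupWithZero Γ]
  {v : Valuation K Γ} {W : ValuationSubring Ks} {p : ℕ}

theorem Valuation.map_natCast_lt_one_of_residueField
    (hres : CharP (IsLocalRing.ResidueField v.valuationSubring) p) : v (p : K) < 1 := by
  have h : IsLocalRing.residue v.valuationSubring (p : v.valuationSubring) = 0 := by
    rw [map_natCast]
    exact CharP.cast_eq_zero _ p
  rw [IsLocalRing.residue_eq_zero_iff, ValuationSubring.valuation_lt_one_iff] at h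
  have h' : v.valuationSubring.valuation (p : K) < v.valuationSubring.valuation 1 := by
    rw [map_one]
    exact_mod_cast h
  rw [← v.isEquiv_valuation_valuationSubring.lt_iff_lt, map_one] at h'
  exact h'

theorem charP_or_charZero_of_residueField (hp : p.Prime)
    (hres : CharP (IsLocalRing.ResidueField v.valuationSubring) p) : CharP K p ∨ CharZero K := by
  by_cases h0 : (p : K) = 0
  · have := Fact.mk hp
    exact Or.inl ((CharP.charP_iff_prime_eq_zero hp).2 h0)
  · right
    obtain ⟨q, hq⟩ := CharP.exists K
    rcases CharP.char_is_prime_or_zero K q with hqp | rfl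
    · exfalso
      have hq0 : (q : v.valuationSubring) = 0 := by
        apply v.valuationSubring.subtype_injective
        rw [map_natCast, map_zero]
        exact CharP.cast_eq_zero K q
      have hqr : (q : IsLocalRing.ResidueField v.valuationSubring) = 0 := by
        rw [← map_natCast (IsLocalRing.residue v.valuationSubring), hq0, map_zero]
      have hdvd := (CharP.cast_eq_zero_iff _ p q).1 hqr
      rw [(Nat.prime_dvd_prime_iff_eq hp hqp).1 hdvd] at h0
      exact h0 (CharP.cast_eq_zero K q)
    · exact CharP.charP_to_charZero K

theorem ValGroup.pow_ne_of_forall {γ : ValGroup v} (h : ∀ δ : ValGroup v, δ ^ p ≠ γ) {x : K}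
    (hx : v x = ((γ : Γˣ) : Γ)) (hp : p ≠ 0) (k : K) : v k ^ p ≠ v x := by
  intro hk
  have hk0 : k ≠ 0 := by
    rintro rfl
    rw [map_zero, zero_pow hp, hx] at hk
    exact Units.ne_zero _ hk.symm
  refine h (ValGroup.mk v hk0) ((ValGroup.ext_iff' v).2 ?_)
  rw [← hx, ← hk]
  simp [ValGroup.mk]

theorem valueIn_groupG (hp0 : (p : K) ≠ 0) : ValueIn v (groupG v p) (p : K) :=
  ⟨ValGroup.mk v hp0, subset_isolatedHull _ rfl, rfl⟩

theorem valueIn_groupG_of_le (hp0 : (p : K) ≠ 0) {k : K} (h₁ : v p ≤ v k) (h₂ : v k ≤ 1) :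
    ValueIn v (groupG v p) k :=
  ValueIn.of_le (isolatedHull_ordConnected _) (valueIn_groupG hp0) valueIn_one h₁
    (by rwa [map_one])

theorem hasRamifiedExtension_of_not_isPDivisible_groupG [IsSepClosure K Ks] (hp : p.Prime)
    (hp0 : (p : K) ≠ 0) (hvp : v (p : K) < 1)
    (hW : W.comap (algebraMap K Ks) = v.valuationSubring) {ε : Ks} (hε : IsPrimitiveRoot ε p)
    (h : ¬ IsPDivisible p (groupG v p)) : HasRamifiedExtension K W.valuation p := by
  have hfact : Fact p.Prime := ⟨hp⟩
  have hwp : W.valuation (p : Ks) < 1 := by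
    have := (valuation_algebraMap_lt_iff hW (p : K) 1).2 (by rwa [map_one])
    rwa [map_natCast, map_one, map_one] at this
  obtain ⟨γ, hγ, hne⟩ := exists_not_pow_of_not_isPDivisible hp.ne_zero
    (isolatedHull_ordConnected _) h
  obtain ⟨π, hπ, n, h₁, h₂⟩ := exists_pow_le_of_mem_isolatedHull (fun δ (hδ : _ = _) ↦ by
    change ((δ : Γˣ) : Γ) ≤ 1
    rw [hδ]
    exact hvp.le) hγ
  rcases hπ with rfl | (hπ : _ = _)
  · rw [one_pow] at h₁
    rw [one_pow, inv_one] at h₂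
    exact (hne 1 (by rw [one_pow, le_antisymm h₂ h₁])).elim
  have hπ1 : π < 1 := by
    change ((π : Γˣ) : Γ) < 1
    rwa [hπ]
  -- Here π = v(p). If it is a p-th power, γ is moved modulo p-th powers strictly between v(p) and 1
  -- and realized by `a`; up to p-th powers p a ^ (p - 1) then has the value of a⁻¹. If it is not, a
  -- = 1 suffices.
  by_cases hη : ∃ η : ValGroup v, η ^ p = π
  · obtain ⟨η, hη⟩ := hη
    obtain ⟨γ', hlt, hlt1, hne'⟩ := exists_between_of_not_pow hη hne h₁ h₂ hπ1
    obtain ⟨a, ha⟩ := ValGroup.exists_eq v γ'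
    obtain ⟨e, he⟩ := ValGroup.exists_eq v η
    have hep : v e ^ p = v p := by
      rw [he, ← hπ, ← hη]
      simp
    have hva1 : v a < 1 := ha ▸ hlt1
    have hvpa : v p < v a := by
      rw [ha, ← hπ]
      exact hlt
    have ha0 : v a ≠ 0 := by
      rw [ha]
      exact Units.ne_zero _
    have hvp0 : v (p : K) ≠ 0 := v.ne_zero_iff.2 hp0
    refine hasRamifiedExtension_of_lt hε W.valuation hp0 hwp (a := a) ?_ ?_ ?_
    · exact (valuation_algebraMap_le_one_iff hW a).2 hva1.le
    · have := (valuation_algebraMap_lt_iff hW (p : K) a).2 hvpa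
      rwa [map_natCast] at this
    · intro k hk
      rw [← map_pow, ← map_pow, valuation_algebraMap_eq_iff hW, map_pow, map_mul, map_pow] at hk
      refine ValGroup.pow_ne_of_forall hne' ha hp.ne_zero (e * a / k) ?_
      rw [map_div₀, div_pow, ← hk, map_mul, mul_pow, hep, mul_div_mul_left _ _ hvp0,
        ← Nat.sub_one_add_one hp.ne_zero, pow_succ, Nat.add_sub_cancel,
        mul_div_cancel_left₀ _ (pow_ne_zero _ ha0)]
  · push Not at hη
    refine hasRamifiedExtension_of_lt hε W.valuation hp0 hwp (a := 1) (by simp)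
      (by simpa using hwp) ?_
    intro k hk
    rw [one_pow, mul_one, ← map_pow, ← map_pow, valuation_algebraMap_eq_iff hW, map_pow] at hk
    exact ValGroup.pow_ne_of_forall hη hπ.symm hp.ne_zero k hk.symm

theorem hasRamifiedExtension_of_charP_of_not_isPDivisible [IsSepClosure K Ks] (hp : p.Prime)
    [CharP K p] (hW : W.comap (algebraMap K Ks) = v.valuationSubring)
    (h : ¬ IsPDivisible p (⊤ : Subgroup (ValGroup v))) :
    HasRamifiedExtension K W.valuation p := by
  have hfact : Fact p.Prime := ⟨hp⟩
  -- Inversion, if necessary, gives `a` a pole.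
  obtain ⟨γ, hγ1, hne⟩ : ∃ γ : ValGroup v, 1 < γ ∧ ∀ δ : ValGroup v, δ ^ p ≠ γ := by
    simp only [IsPDivisible, not_forall, not_exists, not_and] at h
    obtain ⟨γ, -, hne⟩ := h
    rcases lt_trichotomy γ 1 with h1 | h1 | h1
    · exact ⟨γ⁻¹, one_lt_inv'.2 h1, fun δ hδ ↦ hne δ⁻¹ trivial (by rw [inv_pow, hδ, inv_inv])⟩
    · exact (hne 1 trivial (by rw [one_pow, h1])).elim
    · exact ⟨γ, h1, fun δ ↦ hne δ trivial⟩
  obtain ⟨a, ha⟩ := ValGroup.exists_eq v γ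
  refine hasRamifiedExtension_of_charP W.valuation (a := a) ?_ fun k hk ↦ ?_
  · have := (valuation_algebraMap_lt_iff hW 1 a).2 (by rw [map_one, ha]; exact hγ1)
    rwa [map_one, map_one] at this
  · rw [← map_pow, ← map_pow, valuation_algebraMap_eq_iff hW, map_pow] at hk
    exact ValGroup.pow_ne_of_forall hne ha hp.ne_zero k hk.symm

/-- The values `w ((ε - c) ^ m)`, where `m = [K(ε) : K]` and `c ≠ ε` runs over the valuation ring
of `v`. -/
def closenessSet (v : Valuation K Γ) (W : ValuationSubring Ks) (ε : Ks) : Set (ValGroup v) :=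
  {γ : ValGroup v | ∃ c x : K, v c ≤ 1 ∧ algebraMap K Ks c ≠ ε ∧ ((γ : Γˣ) : Γ) = v x ∧
    W.valuation (algebraMap K Ks x) =
      W.valuation (ε - algebraMap K Ks c) ^ Module.finrank K K⟮ε⟯}

theorem groupDelta_eq_isolatedHull {Γ' : Type*} [LinearOrderedCommGroupWithZero Γ'] {ε : Ks}
    {v' : Valuation K⟮ε⟯ Γ'} (hW' : W.comap (algebraMap K⟮ε⟯ Ks) = v'.valuationSubring)
    {Kh : IntermediateField K Ks} (hε : ε ∈ Kh) :
    groupDelta v p Kh ε v' = isolatedHull (closenessSet v W ε) := by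
  rw [groupDelta, if_pos hε, closenessSet]
  have hiff := fun x y ↦ (ValuationSubring.isEquiv_of_comap_eq hW').eq_iff (r := x) (s := y)
  congr 1
  ext γ
  refine exists₂_congr fun c x ↦ and_congr_right fun _ ↦ and_congr_right fun _ ↦
    and_congr_right fun _ ↦ ?_
  rw [← hiff, Valuation.comap_apply, Valuation.comap_apply, map_pow (algebraMap K⟮ε⟯ Ks), map_pow]
  rfl

section

variable {ε : Ks}

theorem map_le_of_primitiveRoot (hp : p.Prime) (hvp : v (p : K) < 1)
    (hW : W.comap (algebraMap K Ks) = v.valuationSubring) (hε : IsPrimitiveRoot ε p) :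
    W.valuation (ε - 1) < 1 ∧ W.valuation (p : Ks) ≤ W.valuation (ε - 1) := by
  have hfact : Fact p.Prime := ⟨hp⟩
  have hwp : W.valuation (p : Ks) < 1 := by
    have := (valuation_algebraMap_lt_iff hW (p : K) 1).2 (by rwa [map_one])
    rwa [map_natCast, map_one, map_one] at this
  have hl := W.valuation.map_sub_one_lt_one_of_primitiveRoot hε hwp
  refine ⟨hl, ?_⟩
  rw [← W.valuation.map_primitiveRoot_sub_one_pow hp hε]
  exact pow_le_of_le_one zero_le hl.le (Nat.sub_ne_zero_of_lt hp.one_lt)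

theorem le_one_of_mem_closenessSet (hp : p.Prime)
    (hW : W.comap (algebraMap K Ks) = v.valuationSubring) (hε : IsPrimitiveRoot ε p) :
    ∀ γ ∈ closenessSet v W ε, γ ≤ 1 := by
  rintro γ ⟨c, x, hc, -, hγ, hx⟩
  change ((γ : Γˣ) : Γ) ≤ 1
  rw [hγ, ← valuation_algebraMap_le_one_iff hW, hx]
  exact pow_le_one' (W.valuation.map_sub_le (W.valuation.map_primitiveRoot hp hε).le
    ((valuation_algebraMap_le_one_iff hW c).2 hc)) _

theorem hasRamifiedExtension_of_not_isPDivisible_isolatedHull [IsSepClosure K Ks] (hp : p.Prime)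
    (hp0 : (p : K) ≠ 0) (hvp : v (p : K) < 1)
    (hW : W.comap (algebraMap K Ks) = v.valuationSubring) (hε : IsPrimitiveRoot ε p)
    (hG : IsPDivisible p (groupG v p))
    (h : ¬ IsPDivisible p (isolatedHull (closenessSet v W ε))) :
    HasRamifiedExtension K W.valuation p := by
  have hfact : Fact p.Prime := ⟨hp⟩
  obtain ⟨hl1, hpl⟩ := map_le_of_primitiveRoot hp hvp hW hε
  have hGmem : ∀ x : K, (∀ k, v k ^ p ≠ v x) → ¬ ValueIn v (groupG v p) x := by
    intro x hx hmem
    obtain ⟨k, -, hk⟩ := hG.exists_valueIn hmem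
    exact hx k hk
  have hle_of : ∀ x : K, W.valuation (ε - 1) ≤ W.valuation (algebraMap K Ks x) →
      v x ≤ 1 → ValueIn v (groupG v p) x := by
    intro x hx hx1
    refine valueIn_groupG_of_le hp0 ?_ hx1
    rw [← valuation_algebraMap_le_iff hW, map_natCast]
    exact hpl.trans hx
  obtain ⟨γ, hγ, hne⟩ := exists_not_pow_of_not_isPDivisible hp.ne_zero
    (isolatedHull_ordConnected _) h
  obtain ⟨π, hπ, n, h₁, h₂⟩ :=
    exists_pow_le_of_mem_isolatedHull (le_one_of_mem_closenessSet hp hW hε) hγ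
  rcases hπ with rfl | ⟨c, x, hc1, hcε, hπx, hx⟩
  · rw [one_pow] at h₁
    rw [one_pow, inv_one] at h₂
    exact (hne 1 (by rw [one_pow, le_antisymm h₂ h₁])).elim
  set m := Module.finrank K K⟮ε⟯ with hm
  obtain ⟨g₀, hg₀⟩ := ValGroup.exists_eq v γ
  -- If c were no closer to ε than 1 is, π would be bounded by a power of v(p), so γ would lie in
  -- the p-divisible group G(K).
  have hclose : W.valuation (ε - algebraMap K Ks c) < W.valuation (ε - 1) := by
    by_contra! hle
    refine hGmem g₀ (ValGroup.pow_ne_of_forall hne hg₀ hp.ne_zero) ?_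
    have hpx : ValueIn v (groupG v p) x := by
      refine ValueIn.of_le (isolatedHull_ordConnected _) ((valueIn_groupG hp0).pow m)
        valueIn_one ?_ ?_
      · rw [← valuation_algebraMap_le_iff hW, hx, map_pow, map_pow, map_natCast]
        exact pow_le_pow_left' (hpl.trans hle) m
      · rw [map_one, ← hπx]
        exact le_one_of_mem_closenessSet hp hW hε π ⟨c, x, hc1, hcε, hπx, hx⟩
    refine ValueIn.of_le (isolatedHull_ordConnected _) (hpx.pow n) (hpx.pow n).inv ?_ ?_
    · rw [map_pow, hg₀, ← hπx]
      exact h₁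
    · have h₂' : ((γ : Γˣ) : Γ) ≤ (((π ^ n)⁻¹ : ValGroup v) : Γˣ) := h₂
      rw [map_inv₀, map_pow, hg₀, ← hπx]
      simpa using h₂'
  obtain ⟨g, hg⟩ := exists_map_sub_eq (K := K) hε W.valuation hclose
  have hl := map_sub_one_eq_of_lt W.valuation hclose
  have hl' : W.valuation (ε - 1) = W.valuation (algebraMap K Ks (c - 1)) := by
    rw [hl, map_sub (algebraMap K Ks), map_one]
  obtain ⟨k₁, -, hk₁⟩ := hG.exists_valueIn (hle_of (c - 1) hl'.le (by
    rw [← valuation_algebraMap_le_one_iff hW, ← hl']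
    exact hl1.le))
  have hk₁' : W.valuation (ε - 1) = W.valuation (algebraMap K Ks k₁) ^ p := by
    rw [hl', ← map_pow, ← map_pow, valuation_algebraMap_eq_iff hW, map_pow, hk₁]
  have hg0 : g ≠ 0 := by
    rintro rfl
    rw [map_zero, map_zero, map_eq_zero, sub_eq_zero] at hg
    exact hcε hg.symm
  have hvg1 : v g < 1 := by
    have : W.valuation (algebraMap K Ks g) < W.valuation (algebraMap K Ks 1) := by
      rw [← hg, map_one, map_one]
      exact hclose.trans hl1
    rwa [valuation_algebraMap_lt_iff hW, map_one] at this
  -- If w(ε - c) is not a p-th power, `c` itself serves. Otherwise γ is moved modulo p-th powers to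
  -- the value of some `a` between w(ε - c) and 1, and c + a is at distance exactly w(a) from ε.
  -- Being no p-th power, w(a) cannot lie in G(K), so c + a is still closer to ε than 1 is.
  by_cases hη : ∃ η : ValGroup v, η ^ p = ValGroup.mk v hg0
  · obtain ⟨η, hη⟩ := hη
    have hπg : ValGroup.mk v hg0 ^ m = π := by
      rw [ValGroup.ext_iff', hπx]
      change v g ^ m = v x
      rw [← map_pow, ← valuation_algebraMap_eq_iff hW, map_pow, map_pow, ← hg, hx]
    rw [← hπg, ← pow_mul] at h₁ h₂
    obtain ⟨γ', hlt, hlt1, hne'⟩ := exists_between_of_not_pow hη hne h₁ h₂ hvg1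
    obtain ⟨a, ha⟩ := ValGroup.exists_eq v γ'
    have hane := ValGroup.pow_ne_of_forall hne' ha hp.ne_zero
    have hga : W.valuation (algebraMap K Ks g) < W.valuation (algebraMap K Ks a) := by
      rw [valuation_algebraMap_lt_iff hW, ha]
      exact hlt
    have hval : W.valuation (ε - algebraMap K Ks (c + a)) = W.valuation (algebraMap K Ks a) := by
      rw [map_add (algebraMap K Ks), ← sub_sub]
      exact W.valuation.map_sub_eq_of_lt_right (hg ▸ hga)
    refine hasRamifiedExtension_of_close hε W.valuation hp0 (c := c + a) (g := a) (k₁ := k₁) ?_ hk₁'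
      hval fun k hk ↦ ?_
    · rw [hval]
      by_contra! hle
      refine hGmem a hane (hle_of a hle ?_)
      rw [ha]
      exact hlt1.le
    · rw [← map_pow, ← map_pow, valuation_algebraMap_eq_iff hW, map_pow] at hk
      exact hane k hk.symm
  · push Not at hη
    refine hasRamifiedExtension_of_close hε W.valuation hp0 hclose hk₁' hg fun k hk ↦ ?_
    rw [← map_pow, ← map_pow, valuation_algebraMap_eq_iff hW, map_pow] at hk
    exact ValGroup.pow_ne_of_forall hη rfl hp.ne_zero k hk.symm

/-- In the coarsening with respect to a subgroup containing the value of `p`, distinct `p`-th roots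
of unity are incongruent. -/
theorem coarsening_valuation_sub_one (hp : p.Prime)
    {hW : W.comap (algebraMap K Ks) = v.valuationSubring} (hε : IsPrimitiveRoot ε p)
    {D : Subgroup (ValGroup v)} (hpD : ValueIn v D (p : K)) :
    (coarsening W hW D).valuation (ε - 1) = 1 := by
  have h1 := coarsening_valuation_algebraMap (W := W) (hW := hW) hpD
  rw [map_natCast, ← Valuation.map_primitiveRoot_sub_one_pow _ hp hε] at h1
  exact (pow_eq_one_iff_of_nonneg zero_le (Nat.sub_ne_zero_of_lt hp.one_lt)).1 h1

open scoped Pointwise in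
-- An element τ of the decomposition group preserves the coarsening, so τ ε ≡ c ≡ ε; distinct p-th
-- roots of unity are incongruent there.
theorem mem_fixedField_decompositionSubgroup (hp : p.Prime)
    {hW : W.comap (algebraMap K Ks) = v.valuationSubring} (hε : IsPrimitiveRoot ε p)
    {D : Subgroup (ValGroup v)} (hpD : ValueIn v D (p : K)) {c : K}
    (hc : (coarsening W hW D).valuation (ε - algebraMap K Ks c) < 1) :
    ε ∈ IntermediateField.fixedField (W.decompositionSubgroup K) := by
  rintro ⟨τ, hτ⟩
  change τ ε = ε
  by_contra hne
  have hτ' := (W.decompositionSubgroup K).inv_mem hτ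
  have hstab : ∀ x ∈ W, τ⁻¹ x ∈ W := by
    intro x hx
    have h1 : τ⁻¹ • W = W := hτ'
    rw [← h1]
    exact ValuationSubring.smul_mem_pointwise_smul τ⁻¹ x W hx
  have hstab' : ∀ x, (coarsening W hW D).valuation x ≤ 1 →
      (coarsening W hW D).valuation (τ⁻¹ x) ≤ 1 := by
    intro x hx
    rw [ValuationSubring.valuation_le_one_iff, mem_coarsening] at hx ⊢
    obtain ⟨d, hd, hmem⟩ := hx
    refine ⟨d, hd, ?_⟩
    have := hstab _ hmem
    rwa [map_mul, AlgEquiv.commutes] at this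
  have h1 := Valuation.map_lt_one_of_symm_stable _ hstab' hc
  rw [map_sub, AlgEquiv.commutes] at h1
  have h2 : (coarsening W hW D).valuation (τ ε - ε) < 1 := by
    rw [← sub_sub_sub_cancel_right (τ ε) ε (algebraMap K Ks c)]
    exact Valuation.map_sub_lt _ h1 hc
  have : NeZero p := ⟨hp.ne_zero⟩
  have hdiv : τ ε - ε = ε * (τ ε / ε - 1) := by
    have := hε.ne_zero hp.ne_zero
    field_simp
  obtain ⟨i, hi, hi'⟩ := hε.eq_pow_of_pow_eq_one (ξ := τ ε / ε) (by
    rw [div_pow, ← map_pow, hε.pow_eq_one, map_one, div_one])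
  rw [hdiv, ← hi', map_mul, Valuation.map_primitiveRoot _ hp hε, one_mul,
    Valuation.map_primitiveRoot_pow_sub_one _ hp hε, coarsening_valuation_sub_one hp hε hpD] at h2
  · exact lt_irrefl _ h2
  · intro hd
    rw [Nat.eq_zero_of_dvd_of_lt hd hi, pow_zero, eq_comm,
      div_eq_one_iff_eq (hε.ne_zero hp.ne_zero)] at hi'
    exact hne hi'

/-- The choice c = 1 puts w(ε - 1) ^ m in Δ(v), through the norm of ε - 1. Its power p - 1 is w(p) ^
m ≤ w(p), and convexity gives v(p). -/
theorem valueIn_isolatedHull_closenessSet [IsSepClosure K Ks] (hp : p.Prime)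
    (hvp : v (p : K) < 1) (hW : W.comap (algebraMap K Ks) = v.valuationSubring)
    (hε : IsPrimitiveRoot ε p) :
    ValueIn v (isolatedHull (closenessSet v W ε)) (p : K) := by
  have hfact : Fact p.Prime := ⟨hp⟩
  set m := Module.finrank K K⟮ε⟯ with hm
  obtain ⟨k, hk⟩ := prod_conj_mem_range (K := K) hε (f := fun x ↦ x - 1) (fun g x ↦ by simp)
  have hwk : W.valuation (algebraMap K Ks k) = W.valuation (ε - 1) ^ m := by
    rw [hk, map_prod, hm, ← card_conjExponents hε, ← Finset.prod_const]
    refine Finset.prod_congr rfl fun t _ ↦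
      W.valuation.map_primitiveRoot_pow_sub_one hp hε fun hd ↦ ?_
    have h0 := Nat.eq_zero_of_dvd_of_lt hd (ZMod.val_lt (t : ZMod p))
    rw [ZMod.val_eq_zero] at h0
    exact t.ne_zero h0
  obtain ⟨hl1, hpl⟩ := map_le_of_primitiveRoot hp hvp hW hε
  have hε1 : ε ≠ 1 := hε.ne_one hp.one_lt
  have hk0 : k ≠ 0 := by
    rintro rfl
    rw [map_zero, map_zero] at hwk
    exact pow_ne_zero m (W.valuation.ne_zero_iff.2 (sub_ne_zero.2 hε1)) hwk.symm
  have hkin : ValueIn v (isolatedHull (closenessSet v W ε)) k :=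
    ⟨ValGroup.mk v hk0, subset_isolatedHull _ ⟨1, k, by simp, by simpa using hε1.symm, rfl,
      by rw [map_one, hwk]⟩, rfl⟩
  have hm0 : m ≠ 0 := by
    rw [hm, ← card_conjExponents hε]
    exact Finset.card_ne_zero_of_mem (one_mem_conjExponents hε)
  refine ValueIn.of_le (isolatedHull_ordConnected _) (hkin.pow (p - 1)) valueIn_one ?_ ?_
  · rw [← valuation_algebraMap_le_iff hW, map_pow, map_pow, hwk, map_natCast,
      ← W.valuation.map_primitiveRoot_sub_one_pow hp hε, ← pow_mul, mul_comm, pow_mul]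
    exact pow_le_of_le_one zero_le (pow_le_one' hl1.le _) hm0
  · rw [map_one]
    exact hvp.le

theorem isPDivisible_top_of_isTotallyRamified [IsSepClosure K Ks] (hp : p.Prime)
    (hvp : v (p : K) < 1)
    (hW : W.comap (algebraMap K Ks) = v.valuationSubring) (hHens : IsPHenselian v p Ks)
    (hε : IsPrimitiveRoot ε p)
    (hD : IsPDivisible p (isolatedHull (closenessSet v W ε)))
    {L : IntermediateField K Ks} (hL : L ≤ maximalPExtension p K Ks)
    (hfin : Module.finrank K L = p) (hTR : IsTotallyRamified v L) :
    IsPDivisible p (⊤ : Subgroup (ValGroup v)) := by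
  have hfact : Fact p.Prime := ⟨hp⟩
  by_contra htop
  set D := isolatedHull (closenessSet v W ε) with hDdef
  have hconv : (D : Set (ValGroup v)).OrdConnected := isolatedHull_ordConnected _
  have hpD : ValueIn v D (p : K) := valueIn_isolatedHull_closenessSet hp hvp hW hε
  obtain ⟨c₀, hc₀⟩ :=
    exists_coarsening_valuation_sub_lt_one hp hW hHens hε hconv hD hpD hL hfin hTR
  set u := (coarsening W hW D).valuation with hu
  -- The definition of Δ(v) excludes c = ε. In that case c is shifted by an element small in the
  -- coarsening, which exists because `D`, being p-divisible, is not the whole value group.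
  obtain ⟨c, hcε, hc⟩ : ∃ c : K, algebraMap K Ks c ≠ ε ∧ u (ε - algebraMap K Ks c) < 1 := by
    by_cases h0 : algebraMap K Ks c₀ = ε
    · have hDtop : D ≠ ⊤ := fun h ↦ htop (h ▸ hD)
      obtain ⟨γ, hγ⟩ : ∃ γ : ValGroup v, γ ∉ D := by
        by_contra! hall
        exact hDtop (Subgroup.eq_top_iff' D |>.2 hall)
      obtain ⟨γ, hγ1, hγ⟩ : ∃ γ : ValGroup v, γ ≤ 1 ∧ γ ∉ D := by
        rcases le_total γ 1 with h | h
        · exact ⟨γ, h, hγ⟩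
        · exact ⟨γ⁻¹, inv_le_one'.2 h, fun hmem ↦ hγ (inv_mem_iff.1 hmem)⟩
      obtain ⟨a, ha⟩ := ValGroup.exists_eq v γ
      have ha0 : a ≠ 0 := by
        rintro rfl
        rw [map_zero] at ha
        exact Units.ne_zero _ ha.symm
      have hua : u (algebraMap K Ks a) < 1 := by
        refine lt_of_le_of_ne ?_ fun h1 ↦ ?_
        · rw [hu, ← map_one (coarsening W hW D).valuation]
          apply coarsening_valuation_mono
          rw [map_one, valuation_algebraMap_le_one_iff hW, ha]
          exact hγ1
        · obtain ⟨δ, hδ, h2⟩ := valueIn_of_coarsening_valuation_eq_one hconv h1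
          rw [ha] at h2
          rw [(ValGroup.ext_iff' v).2 h2] at hδ
          exact hγ hδ
      refine ⟨c₀ - a, ?_, ?_⟩
      · rw [map_sub, h0, Ne, sub_eq_self, map_eq_zero]
        exact ha0
      · rwa [map_sub (algebraMap K Ks), h0, sub_sub_cancel]
    · exact ⟨c₀, h0, hc₀⟩
  have hul : u (ε - 1) = 1 := coarsening_valuation_sub_one hp hε hpD
  have hclose : W.valuation (ε - algebraMap K Ks c) < W.valuation (ε - 1) :=
    lt_of_coarsening_valuation_lt (hW := hW) (D := D) (by rw [← hu, hul]; exact hc)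
  obtain ⟨g, hg⟩ := exists_map_sub_eq (K := K) hε W.valuation hclose
  set m := Module.finrank K K⟮ε⟯ with hm
  have hg0 : g ≠ 0 := by
    rintro rfl
    rw [map_zero, map_zero, map_eq_zero, sub_eq_zero] at hg
    exact hcε hg.symm
  have hc1 : v c ≤ 1 := by
    rw [← valuation_algebraMap_le_one_iff hW, ← sub_sub_cancel ε (algebraMap K Ks c)]
    refine W.valuation.map_sub_le (W.valuation.map_primitiveRoot hp hε).le ?_
    exact (hclose.trans (map_le_of_primitiveRoot hp hvp hW hε).1).le
  have hgm : ValueIn v D (g ^ m) :=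
    ⟨ValGroup.mk v (pow_ne_zero m hg0), subset_isolatedHull _ ⟨c, g ^ m, hc1, hcε, rfl,
      by rw [map_pow, map_pow, hg]⟩, rfl⟩
  have h1 := coarsening_valuation_algebraMap (W := W) (hW := hW) hgm
  have hug : u (ε - algebraMap K Ks c) = u (algebraMap K Ks g) := coarsening_valuation_congr hg
  rw [map_pow, map_pow, ← hu, ← hug] at h1
  have hm0 : m ≠ 0 := by
    rw [hm, ← card_conjExponents hε]
    exact Finset.card_ne_zero_of_mem (one_mem_conjExponents hε)
  exact hc.ne ((pow_eq_one_iff_of_nonneg zero_le hm0).1 h1)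

end

end Criteria

/-! ### The main equivalence. -/

theorem corollary6p5 {K Γ Γ' Ks : Type*} [Field K] [LinearOrderedCommGroupWithZero Γ]
    [LinearOrderedCommGroupWithZero Γ'] [Field Ks] [Algebra K Ks] [IsSepClosure K Ks]
    (p : ℕ) (hp : p.Prime) (v : Valuation K Γ)
    (hres : CharP (IsLocalRing.ResidueField v.valuationSubring) p)
    (hHens : IsPHenselian v p Ks)
    (hval : ¬ IsPDivisible p (⊤ : Subgroup (ValGroup v)))
    (Kh : IntermediateField K Ks) (hKh : IsHenselizationIn v Kh)
    (ε : Ks) (hε : (p : K) ≠ 0 → IsPrimitiveRoot ε p)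
    (v' : Valuation K⟮ε⟯ Γ') (hv' : v.HasExtension v') :
    (¬ ∃ L : IntermediateField K Ks, L ≤ maximalPExtension p K Ks ∧
        Module.finrank K L = p ∧ IsTotallyRamified v L) ↔
      CharZero K ∧
        ((IsPDivisible p (groupG v p) ∧ ¬ ∃ ζ ∈ Kh, IsPrimitiveRoot ζ p) ∨
          ((∃ ζ ∈ Kh, IsPrimitiveRoot ζ p) ∧
            IsPDivisible p (groupDelta v p Kh ε v'))) := by
  have hvp := Valuation.map_natCast_lt_one_of_residueField hres
  -- `W` extends `v'`, so the values defining Δ(v) can be computed in `Ks`.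
  obtain ⟨W, hWE⟩ := ValuationSubring.exists_comap_eq (algebraMap K⟮ε⟯ Ks) v'.valuationSubring
  have hW : W.comap (algebraMap K Ks) = v.valuationSubring := by
    rw [IsScalarTower.algebraMap_eq K K⟮ε⟯ Ks, ← ValuationSubring.comap_comap, hWE]
    exact ((Valuation.isEquiv_iff_valuationSubring _ _).1 hv'.val_isEquiv_comap).symm
  constructor
  · intro hno
    have hnr : ¬ HasRamifiedExtension K W.valuation p := fun h ↦
      hno (h.exists_isTotallyRamified hp hW)
    rcases charP_or_charZero_of_residueField hp hres with hchar | hchar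
    · exact (hnr (hasRamifiedExtension_of_charP_of_not_isPDivisible hp hW hval)).elim
    have hp0 : (p : K) ≠ 0 := Nat.cast_ne_zero.2 hp.ne_zero
    have hprim := hε hp0
    have hG : IsPDivisible p (groupG v p) := by
      by_contra hG
      exact hnr (hasRamifiedExtension_of_not_isPDivisible_groupG hp hp0 hvp hW hprim hG)
    refine ⟨hchar, ?_⟩
    by_cases hmem : ε ∈ Kh
    · refine Or.inr ⟨⟨ε, hmem, hprim⟩, ?_⟩
      rw [groupDelta_eq_isolatedHull hWE hmem]
      by_contra hD
      exact hnr (hasRamifiedExtension_of_not_isPDivisible_isolatedHull hp hp0 hvp hW hprim hG hD)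
    · refine Or.inl ⟨hG, ?_⟩
      rintro ⟨ζ, hζ, hζprim⟩
      have : NeZero p := ⟨hp.ne_zero⟩
      obtain ⟨i, -, rfl⟩ := hζprim.eq_pow_of_pow_eq_one hprim.pow_eq_one
      exact hmem (pow_mem hζ i)
  · rintro ⟨hchar, hcases⟩ ⟨L, hL, hfin, hTR⟩
    have hp0 : (p : K) ≠ 0 := Nat.cast_ne_zero.2 hp.ne_zero
    have hprim := hε hp0
    rcases hcases with ⟨hG, hnot⟩ | ⟨⟨ζ, hζ, hζprim⟩, hD⟩
    -- In case (i) the coarsening must be that of the ring `W₀` defining the Henselization, which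
    -- need not be `W`.
    · obtain ⟨W₀, hW₀, rfl⟩ := hKh
      obtain ⟨c, hc⟩ := exists_coarsening_valuation_sub_lt_one hp hW₀ hHens hprim
        (isolatedHull_ordConnected _) hG (valueIn_groupG hp0) hL hfin hTR
      exact hnot ⟨ε, mem_fixedField_decompositionSubgroup hp hprim (valueIn_groupG hp0) hc, hprim⟩
    · have : NeZero p := ⟨hp.ne_zero⟩
      have hmem : ε ∈ Kh := by
        obtain ⟨i, -, rfl⟩ := hζprim.eq_pow_of_pow_eq_one hprim.pow_eq_one
        exact pow_mem hζ i
      rw [groupDelta_eq_isolatedHull hWE hmem] at hD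
      exact hval (isPDivisible_top_of_isTotallyRamified hp hvp hW hHens hprim hD hL hfin hTR)
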